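/- Let $m\geq 2$, let $G=\langle a_1,\ldots,a_m\mid R\rangle$ be a group given by a finite presentation whose relators (words in the $a_i^{\pm1}$) all have length at most $\lambda$, and for $\ell\in\mathbb N$ let $W_\ell$ be the set of reduced words of length $\ell$ in the letters $a_i^{\pm 1}$ that are equal to $e$ in $G$. For a van Kampen diagram $D$ over this presentation, let $|\partial D|$ be the length of its boundary word, let $\mathcal A(D)=\sum_{f}|\partial f|$ (sum over the faces $f$ of $D$, $|\partial f|$ being the boundary length of $f$) be its area, and call $D$ minimal if no van Kampen diagram with the same boundary word has smaller area. Then there is a function $\varepsilon(C,A)$ of two real variables (not depending on $m$, $R$, $\lambda$ or on the numbers $\eta$, $\ell$ below) with $\varepsilon(C,A)\to 0$ as $A\to\infty$ for each fixed $C>0$, and in fact with \[1+\varepsilon(C,A)\leq \exp\frac{200}{C\sqrt A}\qquad (C>0,\ A>1),\] such that the following holds. Suppose that $C>0$ is such that every minimal van Kampen diagram $D$ over the presentation satisfies $|\partial D|\geq C\,\mathcal A(D)$, and that for some $A>1$ and some $\eta\geq 1/2$ one has \[|W_\ell|\leq (2m-1)^{\eta\ell}\qquad\text{for all integers } \ell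 \text{ with } A\lambda/4\leq\ell\leq A\lambda .\] Then \[|W_\ell|\leq (2m-1)^{\eta\ell\,(1+\varepsilon(C,A))}\qquad\text{for all integers } \ell\geq A\lambda/4 .\] -/

import Mathlib

open Filter Topology

namespace Cogrowth

/-- Words in the letters `a_1^{±1}, …, a_m^{±1}`: the letter `(i, true)` is `a_i` and
`(i, false)` is `a_i⁻¹`, as in Mathlib's `FreeGroup`. -/
abbrev Word (m : ℕ) : Type := List (Fin m × Bool)

/-- The group `⟨a_1, …, a_m ∣ R⟩`. -/
abbrev PresGroup {m : ℕ} (R : Finset (Word m)) : Type :=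
  PresentedGroup ((fun r : Word m => FreeGroup.mk r) '' (R : Set (Word m)))

/-- The element of `⟨a_1, …, a_m ∣ R⟩` represented by a word. -/
def eval {m : ℕ} (R : Finset (Word m)) (w : Word m) : PresGroup R :=
  PresentedGroup.mk _ (FreeGroup.mk w)

/-- `W_ℓ`: the reduced words of length `ℓ` that are equal to `e` in `⟨a_1, …, a_m ∣ R⟩`. -/
def W {m : ℕ} (R : Finset (Word m)) (ℓ : ℕ) : Set (Word m) :=
  {w | FreeGroup.IsReduced w ∧ w.length = ℓ ∧ eval R w = 1}

/-- The word read along the cycle of `d` under `next`, starting at `d`. -/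
noncomputable def readCycle {m : ℕ} {Dart : Type} (next : Equiv.Perm Dart)
    (label : Dart → Fin m × Bool) (d : Dart) : Word m :=
  (List.range (Function.minimalPeriod next d)).map fun i => label (next^[i] d)

/-- The number of cycles of a permutation, fixed points included. -/
noncomputable def numCycles {Dart : Type} (f : Equiv.Perm Dart) : ℕ :=
  Nat.card (Quotient (Equiv.Perm.SameCycle.setoid f))

/-- A van Kampen diagram over `⟨a_1, …, a_m ∣ R⟩`: a finite connected simply connected planar
2-complex whose oriented edges bear letters and whose faces bear relators.

It is given as a finite connected map on the sphere (a combinatorial map of genus zero) in which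
one face, the outer one, has been singled out and is not a face of the diagram. The darts are the
oriented edges, `flip` reverses an oriented edge, and `next d` is the oriented edge that follows
`d` when one travels around the face lying on a fixed side of `d`. So the edges are the cycles of
`flip`, the faces of the spherical map are the cycles of `next`, and the vertices are the cycles
of `next * flip` (which permutes the oriented edges with a given origin). The diagram without
darts is the diagram that consists of a single vertex. -/
structure VanKampenDiagram {m : ℕ} (R : Finset (Word m)) where
  /-- The oriented edges. -/
  Dart : Type
  [fintypeDart : Fintype Dart]
  /-- Reversal of oriented edges. -/
  flip : Equiv.Perm Dart
  /-- The successor of an oriented edge on the boundary of the face at its side. -/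
  next : Equiv.Perm Dart
  flip_flip : ∀ d, flip (flip d) = d
  flip_ne : ∀ d, flip d ≠ d
  /-- The underlying graph is connected. -/
  connected : ∀ d e : Dart, ∃ g ∈ Subgroup.closure {flip, next}, g d = e
  /-- Euler's formula `V - E + F = 2`: the surface is a sphere. -/
  euler : Nonempty Dart →
    numCycles (next * flip) + numCycles next = numCycles flip + 2
  /-- The letter on an oriented edge. -/
  label : Dart → Fin m × Bool
  label_flip : ∀ d, label (flip d) = ((label d).1, !(label d).2)
  /-- The base point of the boundary: the oriented edge of the outer face at which the boundary
  word starts. It is absent exactly when the diagram is a single vertex. -/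
  root : Option Dart
  root_eq_none : root = none ↔ IsEmpty Dart
  /-- Each face other than the outer one bears a relator or the inverse of a relator, read from
  some starting point. -/
  face_relator : ∀ d, (∀ o ∈ root, ¬ next.SameCycle o d) →
    ∃ r ∈ R, readCycle next label d ~r r ∨ readCycle next label d ~r FreeGroup.invRev r

namespace VanKampenDiagram

variable {m : ℕ} {R : Finset (Word m)}

attribute [instance] VanKampenDiagram.fintypeDart

/-- The boundary word `∂D`, which is empty for the diagram consisting of a single vertex.
Edges of filaments are read twice. -/
noncomputable def boundaryWord (D : VanKampenDiagram R) : Word m :=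
  match D.root with
  | none => []
  | some o => readCycle D.next D.label o

/-- The faces of the spherical map: those of the diagram, and the outer one. -/
abbrev SphereFace (D : VanKampenDiagram R) : Type :=
  Quotient (Equiv.Perm.SameCycle.setoid D.next)

/-- The faces of the diagram: all faces of the spherical map but the outer one. -/
abbrev Face (D : VanKampenDiagram R) : Type :=
  {f : D.SphereFace // ∀ o ∈ D.root, Quotient.mk _ o ≠ f}

noncomputable instance (D : VanKampenDiagram R) : Fintype D.Face :=
  Fintype.ofFinite _

/-- The boundary length `|∂f|` of a face. -/
noncomputable def faceLength (D : VanKampenDiagram R) (f : D.Face) : ℕ :=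
  Nat.card {d : D.Dart // Quotient.mk (Equiv.Perm.SameCycle.setoid D.next) d = f.1}

/-- The area of a diagram: the sum of the boundary lengths of its faces. -/
noncomputable def area (D : VanKampenDiagram R) : ℕ :=
  ∑ f : D.Face, D.faceLength f

/-- A diagram is minimal if it has minimal area for its boundary word. -/
def IsMinimal (D : VanKampenDiagram R) : Prop :=
  ∀ D' : VanKampenDiagram R, D'.boundaryWord = D.boundaryWord → D.area ≤ D'.area

end VanKampenDiagram

end Cogrowth

namespace Cogrowth

section Trees

variable {D Q : Type}

lemma SameCycle.eq_of_invariant [Finite D] {α : Type*} {σ : Equiv.Perm D} {f : D → α}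
    (hf : ∀ d, f (σ d) = f d) {d e : D} (h : σ.SameCycle d e) : f d = f e := by
  obtain ⟨i, rfl⟩ := h.exists_nat_pow_eq
  induction i with
  | zero => rfl
  | succ i ih =>
    rw [pow_succ', Equiv.Perm.mul_apply, hf]
    exact ih ⟨i, by simp⟩

/-- A function on a cycle of a permutation cannot change at exactly one place. -/
lemma apply_eq_of_unique_jump [Finite D] {α : Type*} {σ : Equiv.Perm D} {f : D → α} {d : D}
    (h : ∀ e, σ.SameCycle d e → e ≠ d → f (σ e) = f e) : f (σ d) = f d := by
  have key : ∀ j : ℕ, f (σ d) = f d ∨ f ((σ ^ j) (σ d)) = f (σ d) := by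
    intro j
    induction j with
    | zero => right; rfl
    | succ j ih =>
      rcases ih with ih | ih
      · exact Or.inl ih
      · by_cases hj : (σ ^ j) (σ d) = d
        · left; rw [← ih, hj]
        · right
          rw [pow_succ', Equiv.Perm.mul_apply, h _ ?_ hj, ih]
          simp [Equiv.Perm.SameCycle.refl]
  obtain ⟨i, hi⟩ := (show σ.SameCycle (σ d) d by simp [Equiv.Perm.SameCycle.refl]).exists_nat_pow_eq
  rcases key i with h1 | h1
  · exact h1
  · rw [← h1, hi]

/-- A choice, for each vertex other than the root `r`, of a dart leaving it towards a vertex of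
smaller depth. -/
structure IsParent (q : D → Q) (flip : D → D) (r : Q) (dep : Q → ℕ) (par : Q → D) : Prop where
  origin : ∀ v, v ≠ r → q (par v) = v
  dep_lt : ∀ v, v ≠ r → dep (q (flip (par v))) < dep v

/-- The darts of the tree given by parent darts. -/
def treeDarts (flip : D → D) (r : Q) (par : Q → D) : Set D :=
  {d | ∃ v, v ≠ r ∧ (d = par v ∨ d = flip (par v))}

lemma exists_isParent [Nonempty D] (q : D → Q) (flip : D → D) (S : Set D) (r : Q)
    (hconn : ∀ X : Set Q, r ∈ X → (∀ d ∈ S, q (flip d) ∈ X → q d ∈ X) → X = Set.univ) :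
    ∃ dep par, IsParent q flip r dep par ∧ ∀ v, v ≠ r → par v ∈ S := by
  classical
  let B : ℕ → Set Q := fun n =>
    Nat.rec (motive := fun _ => Set Q) {r} (fun _ X => X ∪ {v | ∃ d ∈ S, q d = v ∧ q (flip d) ∈ X}) n
  have hB : ∀ v : Q, ∃ n : ℕ, v ∈ B n := by
    have : {v | ∃ n, v ∈ B n} = Set.univ := by
      apply hconn
      · exact ⟨0, rfl⟩
      · rintro d hd ⟨n, hn⟩
        exact ⟨n + 1, Or.inr ⟨d, hd, rfl, hn⟩⟩
    intro v
    exact (Set.ext_iff.1 this v).2 trivial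
  have hpar : ∀ v : Q, v ≠ r → ∃ d : D, d ∈ S ∧ q d = v ∧ Nat.find (hB (q (flip d))) < Nat.find (hB v) := by
    intro v hv
    generalize hn : Nat.find (hB v) = n
    have hmem : v ∈ B n := hn ▸ Nat.find_spec (hB v)
    cases n with
    | zero => exact absurd hmem hv
    | succ n =>
      rcases hmem with hmem | ⟨d, hd, hdv, hmem⟩
      · exact absurd hmem (Nat.find_min (hB v) (by omega))
      · exact ⟨d, hd, hdv, lt_of_le_of_lt (Nat.find_min' _ hmem) (Nat.lt_succ_self n)⟩
  choose! par hpar using hpar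
  exact ⟨fun v => Nat.find (hB v), par, ⟨fun v hv => (hpar v hv).2.1, fun v hv => (hpar v hv).2.2⟩,
    fun v hv => (hpar v hv).1⟩

namespace IsParent

variable {q : D → Q} {flip : D → D} {r : Q} {dep : Q → ℕ} {par : Q → D}

/-- A nonempty set of darts of a finite tree has a leaf besides the root. -/
lemma eq_empty_of_no_leaf [Finite Q] (h : IsParent q flip r dep par) (N : Set D)
    (hflip : ∀ d, flip (flip d) = d) (hN : ∀ d ∈ N, flip d ∈ N)
    (hT : N ⊆ treeDarts flip r par)
    (hdeg : ∀ d ∈ N, q d ≠ r → ∃ e ∈ N, q e = q d ∧ e ≠ d) : N = ∅ := by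
  classical
  by_contra hne
  obtain ⟨d, hd⟩ := Set.nonempty_iff_ne_empty.2 hne
  have hex : ({v | v ≠ r ∧ par v ∈ N} : Set Q).Nonempty := by
    obtain ⟨v, hv, rfl | rfl⟩ := hT hd
    · exact ⟨v, hv, hd⟩
    · exact ⟨v, hv, by simpa [hflip] using hN _ hd⟩
  obtain ⟨v, ⟨hv, hvN⟩, hmax⟩ := (Set.toFinite {v | v ≠ r ∧ par v ∈ N}).exists_maximalFor dep _ hex
  have hqv := h.origin v hv
  obtain ⟨e, heN, hqe, hne⟩ := hdeg _ hvN (by rw [hqv]; exact hv)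
  rw [hqv] at hqe
  obtain ⟨w, hw, rfl | rfl⟩ := hT heN
  · rw [h.origin w hw] at hqe
    exact hne (by rw [hqe])
  · have h1 := h.dep_lt w hw
    rw [hqe] at h1
    have h2 := hmax (j := w) ⟨hw, by simpa [hflip] using hN _ heN⟩ h1.le
    omega

lemma ncard_treeDarts [Finite Q] (h : IsParent q flip r dep par)
    (hflip : ∀ d, flip (flip d) = d) :
    (treeDarts flip r par).ncard + 2 = 2 * Nat.card Q := by
  classical
  let F : {v : Q // v ≠ r} × Bool → D := fun p => if p.2 then par p.1 else flip (par p.1)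
  have hinjpar : ∀ v w, v ≠ r → w ≠ r → par v = par w → v = w := by
    intro v w hv hw hvw
    rw [← h.origin v hv, hvw, h.origin w hw]
  have hne : ∀ v w, v ≠ r → w ≠ r → par v ≠ flip (par w) := by
    intro v w hv hw hvw
    have h1 := h.dep_lt w hw
    rw [← hvw, h.origin v hv] at h1
    have h2 := h.dep_lt v hv
    rw [hvw, hflip, h.origin w hw] at h2
    omega
  have hF : Function.Injective F := by
    rintro ⟨⟨v, hv⟩, b⟩ ⟨⟨w, hw⟩, c⟩ hvw
    cases b <;> cases c <;> simp [F] at hvw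
    · have : par v = par w := by rw [← hflip (par v), hvw, hflip]
      simp [hinjpar v w hv hw this]
    · exact absurd hvw.symm (hne w v hw hv)
    · exact absurd hvw (hne v w hv hw)
    · simp [hinjpar v w hv hw hvw]
  have hrange : treeDarts flip r par = Set.range F := by
    ext d
    constructor
    · rintro ⟨v, hv, rfl | rfl⟩
      · exact ⟨⟨⟨v, hv⟩, true⟩, by simp [F]⟩
      · exact ⟨⟨⟨v, hv⟩, false⟩, by simp [F]⟩
    · rintro ⟨⟨⟨v, hv⟩, b⟩, rfl⟩
      cases b
      · exact ⟨v, hv, Or.inr (by simp [F])⟩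
      · exact ⟨v, hv, Or.inl (by simp [F])⟩
  have h1 : Nat.card {v : Q // v ≠ r} + 1 = Nat.card Q := by
    have := Fintype.ofFinite Q
    rw [Nat.card_eq_fintype_card, Nat.card_eq_fintype_card, Fintype.card_subtype_compl,
      Fintype.card_subtype_eq]
    have : 0 < Fintype.card Q := Fintype.card_pos_iff.2 ⟨r⟩
    omega
  rw [hrange, ← Set.image_univ, Set.ncard_image_of_injective _ hF, Set.ncard_univ, Nat.card_prod,
    show Nat.card Bool = 2 by simp]
  omega

/-- Parent data allow one to define a function by recursion from the root. -/
lemma exists_gauge {G : Type*} [Group G] (h : IsParent q flip r dep par)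
    (l : D → G) :
    ∃ H : Q → G, ∀ v, v ≠ r → H (q (flip (par v))) = H v * l (par v) := by
  classical
  have wf : WellFounded fun v w : Q => dep v < dep w := InvImage.wf dep Nat.lt_wfRel.wf
  let F : ∀ v : Q, (∀ w, dep w < dep v → G) → G := fun v H =>
    if hv : v ≠ r then H (q (flip (par v))) (h.dep_lt v hv) * (l (par v))⁻¹ else 1
  refine ⟨wf.fix F, fun v hv => ?_⟩
  rw [wf.fix_eq F v]
  simp [F, hv]

end IsParent

end Trees

end Cogrowth

namespace Cogrowth

section Maps

variable {D : Type}

/-- The class of a dart in the set of cycles of a permutation. -/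
abbrev cls (σ : Equiv.Perm D) (d : D) : Quotient (Equiv.Perm.SameCycle.setoid σ) :=
  Quotient.mk _ d

lemma cls_eq_iff {σ : Equiv.Perm D} {d e : D} : cls σ d = cls σ e ↔ σ.SameCycle d e :=
  Quotient.eq

lemma cls_apply {σ : Equiv.Perm D} (d : D) : cls σ (σ d) = cls σ d := by
  rw [cls_eq_iff]; simp [Equiv.Perm.SameCycle.refl]

/-- The data of a connected combinatorial map. -/
structure IsMap (flip next : Equiv.Perm D) : Prop where
  flip_flip : ∀ d, flip (flip d) = d
  flip_ne : ∀ d, flip d ≠ d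
  connected : ∀ d e : D, ∃ g ∈ Subgroup.closure {flip, next}, g d = e

lemma closure_invariant {flip next : Equiv.Perm D} {α : Type*} {f : D → α}
    (hflip : ∀ d, f (flip d) = f d) (hnext : ∀ d, f (next d) = f d) {g : Equiv.Perm D}
    (hg : g ∈ Subgroup.closure {flip, next}) (d : D) : f (g d) = f d := by
  induction hg using Subgroup.closure_induction generalizing d with
  | mem x hx =>
    rcases hx with rfl | rfl
    · exact hflip d
    · exact hnext d
  | one => rfl
  | mul x y _ _ hx hy => rw [Equiv.Perm.mul_apply, hx, hy]
  | inv x _ hx => rw [← hx (x⁻¹ d)]; simp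

namespace IsMap

variable {flip next : Equiv.Perm D}

lemma eq_of_invariant (h : IsMap flip next) {α : Type*} {f : D → α}
    (hflip : ∀ d, f (flip d) = f d) (hnext : ∀ d, f (next d) = f d) (d e : D) : f d = f e := by
  obtain ⟨g, hg, rfl⟩ := h.connected d e
  exact (closure_invariant hflip hnext hg d).symm

lemma cls_next (h : IsMap flip next) (d : D) :
    cls (next * flip) (next d) = cls (next * flip) (flip d) := by
  conv_lhs => rw [← h.flip_flip d]
  exact cls_apply (σ := next * flip) (flip d)

lemma exists_tree (h : IsMap flip next) (r : D) :
    ∃ dep par, IsParent (cls (next * flip)) flip (cls (next * flip) r) dep par := by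
  have : Nonempty D := ⟨r⟩
  obtain ⟨dep, par, hp, -⟩ := exists_isParent (cls (next * flip)) flip Set.univ
    (cls (next * flip) r) (by
      intro X hr hX
      have hX1 : ∀ d, (cls (next * flip) (flip d) ∈ X) = (cls (next * flip) d ∈ X) := by
        intro d
        refine propext ⟨fun hd => hX d trivial hd, fun hd => hX (flip d) trivial ?_⟩
        rwa [h.flip_flip]
      ext v
      induction v using Quotient.inductionOn with
      | h d =>
      have := h.eq_of_invariant (f := fun d => cls (next * flip) d ∈ X) hX1
        (fun d => by rw [h.cls_next, hX1]) r d
      exact iff_of_true (this ▸ hr) trivial)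
  exact ⟨dep, par, hp⟩

lemma flip_mem_treeDarts {Q : Type} {r : Q} {par : Q → D} (h : IsMap flip next) {d : D}
    (hd : d ∈ treeDarts flip r par) : flip d ∈ treeDarts flip r par := by
  obtain ⟨v, hv, rfl | rfl⟩ := hd
  · exact ⟨v, hv, Or.inr rfl⟩
  · exact ⟨v, hv, Or.inl (h.flip_flip _)⟩

variable [Finite D]

lemma ncard_univ_eq (h : IsMap flip next) : Nat.card D = 2 * numCycles flip := by
  classical
  have := Fintype.ofFinite D
  have := Fintype.ofFinite (Quotient (Equiv.Perm.SameCycle.setoid flip))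
  have hfib : ∀ b ∈ (Finset.univ : Finset (Quotient (Equiv.Perm.SameCycle.setoid flip))),
      (Finset.univ.filter fun a : D => cls flip a = b).card = 2 := by
    intro b _
    induction b using Quotient.inductionOn with
    | h d =>
    rw [Finset.card_eq_two]
    refine ⟨d, flip d, (h.flip_ne d).symm, ?_⟩
    ext e
    simp only [Finset.mem_filter, Finset.mem_univ, true_and, Finset.mem_insert,
      Finset.mem_singleton]
    constructor
    · intro he
      obtain ⟨i, rfl⟩ := (cls_eq_iff.1 he.symm).exists_nat_pow_eq
      clear he
      induction i with
      | zero => left; rfl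
      | succ i ih =>
        rw [pow_succ', Equiv.Perm.mul_apply]
        rcases ih with ih | ih
        · right; rw [ih]
        · left; rw [ih, h.flip_flip]
    · rintro (rfl | rfl)
      · rfl
      · exact cls_apply d
  rw [Nat.card_eq_fintype_card, numCycles, Nat.card_eq_fintype_card, ← Finset.card_univ,
    Finset.card_eq_sum_card_fiberwise (f := cls flip) (t := Finset.univ) (by simp),
    Finset.sum_congr rfl hfib]
  simp [mul_comm]

/-- The edges that do not lie on a given spanning tree connect the faces. -/
lemma exists_dual_tree (h : IsMap flip next) {r o : D} {dep par}
    (hp : IsParent (cls (next * flip)) flip (cls (next * flip) r) dep par) :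
    ∃ dep' par', IsParent (cls next) flip (cls next o) dep' par' ∧
      treeDarts flip (cls next o) par' ⊆ (treeDarts flip (cls (next * flip) r) par)ᶜ := by
  have : Nonempty D := ⟨o⟩
  set T := treeDarts flip (cls (next * flip) r) par with hT
  obtain ⟨dep', par', hp', hS⟩ := exists_isParent (cls next) flip Tᶜ (cls next o) (by
    intro X ho hX
    have hN : {d | ¬ (cls next (flip d) ∈ X ↔ cls next d ∈ X)} = ∅ := by
      apply hp.eq_empty_of_no_leaf _ h.flip_flip
      · intro d hd
        simp only [Set.mem_ofPred_eq, h.flip_flip] at hd ⊢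
        tauto
      · intro d hd
        by_contra hdT
        have h1 := hX d hdT
        have h2 := hX (flip d) (fun hc => hdT (by simpa [h.flip_flip] using h.flip_mem_treeDarts hc))
        rw [h.flip_flip] at h2
        exact hd ⟨h1, h2⟩
      · intro d hd _
        by_contra hcon'
        have hcon : ∀ e, ¬ (cls next (flip e) ∈ X ↔ cls next e ∈ X) →
            cls (next * flip) e = cls (next * flip) d → e = d :=
          fun e he hq => by_contra fun hne => hcon' ⟨e, he, hq, hne⟩
        apply hd
        have := apply_eq_of_unique_jump (σ := next * flip) (f := fun d => cls next d ∈ X) (d := d)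
          (by
            intro e he hed
            by_contra hfe
            refine hed (hcon e ?_ (cls_eq_iff.2 he).symm)
            intro hiff
            apply hfe
            simp only [Equiv.Perm.mul_apply]
            rw [cls_apply, hiff])
        simp only [Equiv.Perm.mul_apply] at this
        rw [cls_apply] at this
        rw [this]
    ext f
    induction f using Quotient.inductionOn with
    | h d =>
    have := h.eq_of_invariant (f := fun d => cls next d ∈ X)
      (fun d => by
        have := Set.eq_empty_iff_forall_notMem.1 hN d
        simp only [Set.mem_ofPred_eq, not_not] at this
        exact propext this)
      (fun d => by rw [cls_apply]) o d
    exact iff_of_true (this ▸ ho) trivial)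
  refine ⟨dep', par', hp', ?_⟩
  rintro d ⟨v, hv, rfl | rfl⟩
  · exact hS v hv
  · intro hc
    exact hS v hv (by simpa [h.flip_flip] using h.flip_mem_treeDarts hc)

lemma ncard_treeDarts_compl (h : IsMap flip next) {r : D} {dep par}
    (hp : IsParent (cls (next * flip)) flip (cls (next * flip) r) dep par) :
    ((treeDarts flip (cls (next * flip) r) par)ᶜ).ncard + 2 * numCycles (next * flip)
      = 2 * numCycles flip + 2 := by
  have h1 := Set.ncard_add_ncard_compl (treeDarts flip (cls (next * flip) r) par)
  have h2 := hp.ncard_treeDarts h.flip_flip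
  rw [h.ncard_univ_eq] at h1
  simp only [numCycles] at *
  omega

lemma euler_le (h : IsMap flip next) (r : D) :
    numCycles (next * flip) + numCycles next ≤ numCycles flip + 2 := by
  obtain ⟨dep, par, hp⟩ := h.exists_tree r
  obtain ⟨dep', par', hp', hsub⟩ := h.exists_dual_tree (o := r) hp
  have h1 := Set.ncard_le_ncard hsub (Set.toFinite _)
  have h2 := hp'.ncard_treeDarts h.flip_flip
  have h3 := h.ncard_treeDarts_compl hp
  simp only [numCycles] at *
  omega

/-- On a map of genus zero, a labelling by elements of a group that is locally trivial on all faces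
but one is globally trivial. -/
theorem exists_potential (h : IsMap flip next) {G : Type*} [Group G] {l : D → G}
    (hl : ∀ d, l (flip d) = (l d)⁻¹) (o : D)
    (heuler : numCycles (next * flip) + numCycles next = numCycles flip + 2)
    (k : D → G) (hk : ∀ d, ¬ next.SameCycle o d → k (next d) = k d * l d) :
    ∃ H : D → G, ∀ d, H (next d) = H d * l d ∧ H (flip d) = H d * l d := by
  obtain ⟨dep, par, hp⟩ := h.exists_tree o
  obtain ⟨dep', par', hp', hsub⟩ := h.exists_dual_tree (o := o) hp
  have heq : treeDarts flip (cls next o) par' = (treeDarts flip (cls (next * flip) o) par)ᶜ := by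
    apply Set.eq_of_subset_of_ncard_le hsub _ (Set.toFinite _)
    have h2 := hp'.ncard_treeDarts h.flip_flip
    have h3 := h.ncard_treeDarts_compl hp
    simp only [numCycles] at *
    omega
  obtain ⟨H, hH⟩ := hp.exists_gauge l
  let H' : D → G := fun d => H (cls (next * flip) d)
  have hnext : ∀ d, H' (next d) = H' (flip d) := fun d => by simp only [H', h.cls_next]
  have htree : ∀ d ∈ treeDarts flip (cls (next * flip) o) par, H' (flip d) = H' d * l d := by
    rintro d ⟨v, hv, rfl | rfl⟩
    · simp only [H']
      rw [hH v hv, hp.origin v hv]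
    · simp only [H', h.flip_flip, hl]
      rw [hH v hv, hp.origin v hv]
      group
  have hN : {d | H' (flip d) ≠ H' d * l d} = ∅ := by
    apply hp'.eq_empty_of_no_leaf _ h.flip_flip
    · intro d hd hd'
      apply hd
      rw [h.flip_flip, hl] at hd'
      rw [hd']; group
    · intro d hd
      rw [heq]
      exact fun hd' => hd (htree d hd')
    · intro d hd hdo
      by_contra hcon'
      have hcon : ∀ e, H' (flip e) ≠ H' e * l e → cls next e = cls next d → e = d :=
        fun e he hq => by_contra fun hne => hcon' ⟨e, he, hq, hne⟩
      apply hd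
      have hout : ∀ e, next.SameCycle d e → ¬ next.SameCycle o e := fun e he hoe =>
        hdo (cls_eq_iff.2 (he.trans hoe.symm))
      have := apply_eq_of_unique_jump (σ := next) (f := fun d => k d * (H' d)⁻¹) (d := d) (by
        intro e he hed
        have h1 : H' (flip e) = H' e * l e := by
          by_contra hc
          exact hed (hcon e hc (cls_eq_iff.2 he).symm)
        rw [hk e (hout e he), hnext, h1]
        group)
      rw [hk d (hout d (Equiv.Perm.SameCycle.refl _ _)), hnext, mul_assoc] at this
      have h2 := mul_left_cancel this
      rw [mul_inv_eq_iff_eq_mul] at h2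
      rw [h2]; group
  refine ⟨H', fun d => ?_⟩
  have h1 : H' (flip d) = H' d * l d := by
    by_contra hc
    exact Set.eq_empty_iff_forall_notMem.1 hN d hc
  exact ⟨by rw [hnext, h1], h1⟩

end IsMap

end Maps

end Cogrowth

namespace Cogrowth

section Maps

variable {D : Type}

/-- Cellular `1`-cocycles mod 2 of the map given by `flip` and `next` are coboundaries. -/
def Exact (flip next : D → D) : Prop :=
  ∀ c k : D → ZMod 2, (∀ d, c (flip d) = c d) → (∀ d, k (next d) = k d + c d) →
    ∃ h : D → ZMod 2, ∀ d, h (next d) = h d + c d ∧ h (flip d) = h d + c d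

/-- The functions that are constant on the cycles of a permutation. -/
def cycleFunctions (σ : Equiv.Perm D) : Submodule (ZMod 2) (D → ZMod 2) :=
  LinearMap.range (LinearMap.funLeft (ZMod 2) (ZMod 2) (cls σ))

lemma mem_cycleFunctions [Finite D] {σ : Equiv.Perm D} {f : D → ZMod 2} (h : ∀ d, f (σ d) = f d) :
    f ∈ cycleFunctions σ := by
  refine ⟨Quotient.lift f fun a b hab => SameCycle.eq_of_invariant h hab, ?_⟩
  ext d
  rfl

lemma finrank_cycleFunctions [Finite D] (σ : Equiv.Perm D) :
    Module.finrank (ZMod 2) (cycleFunctions σ) ≤ numCycles σ := by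
  classical
  have := Fintype.ofFinite (Quotient (Equiv.Perm.SameCycle.setoid σ))
  refine (LinearMap.finrank_range_le _).trans ?_
  rw [Module.finrank_fintype_fun_eq_card, numCycles, Nat.card_eq_fintype_card]

namespace IsMap

variable {flip next : Equiv.Perm D}

lemma le_euler [Finite D] (h : IsMap flip next) (r : D) (hex : Exact flip next) :
    numCycles flip + 2 ≤ numCycles (next * flip) + numCycles next := by
  classical
  have := Fintype.ofFinite D
  have := Fintype.ofFinite (Quotient (Equiv.Perm.SameCycle.setoid flip))
  let E := Quotient (Equiv.Perm.SameCycle.setoid flip)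
  let c : (D → ZMod 2) → D → ZMod 2 := fun k d => k (next d) + k d
  let L : (D → ZMod 2) →ₗ[ZMod 2] ({e : E // e ≠ cls flip r} → ZMod 2) :=
    { toFun := fun k e => c k e.1.out + c k (flip e.1.out)
      map_add' := by intro k k'; ext e; simp only [c, Pi.add_apply]; ring
      map_smul' := by intro a k; ext e; simp only [c, Pi.smul_apply, smul_eq_mul, RingHom.id_apply]; ring }
  have hL : Module.finrank (ZMod 2) (LinearMap.range L) + 1 ≤ numCycles flip := by
    have h1 := Submodule.finrank_le (LinearMap.range L)
    rw [Module.finrank_fintype_fun_eq_card, Fintype.card_subtype_compl,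
      Fintype.card_subtype_eq] at h1
    have h2 : 0 < Fintype.card E := Fintype.card_pos_iff.2 ⟨cls flip r⟩
    rw [numCycles, Nat.card_eq_fintype_card]
    change _ ≤ Fintype.card E - 1 at h1
    change _ ≤ Fintype.card E
    omega
  have hrk := LinearMap.finrank_range_add_finrank_ker L
  rw [Module.finrank_fintype_fun_eq_card, ← Nat.card_eq_fintype_card, h.ncard_univ_eq] at hrk
  have hout : ∀ d, d = (cls flip d).out ∨ d = flip (cls flip d).out := by
    intro d
    obtain ⟨i, hi⟩ := (cls_eq_iff.1 (Quotient.out_eq (cls flip d))).exists_nat_pow_eq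
    have : ∀ i : ℕ, ((flip ^ i) (cls flip d).out = (cls flip d).out) ∨
        ((flip ^ i) (cls flip d).out = flip (cls flip d).out) := by
      intro i
      induction i with
      | zero => left; rfl
      | succ i ih =>
        rw [pow_succ', Equiv.Perm.mul_apply]
        rcases ih with ih | ih
        · right; rw [ih]
        · left; rw [ih, h.flip_flip]
    have := this i
    rwa [hi] at this
  have htwo : ∀ x y : ZMod 2, x + y = 0 → x = y := by decide
  have hker : LinearMap.ker L ≤ cycleFunctions (next * flip) ⊔ cycleFunctions next := by
    intro k hk
    have hinv' : ∀ d, cls flip d ≠ cls flip r → c k d + c k (flip d) = 0 := by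
      intro d hd
      have h1 : c k (cls flip d).out + c k (flip (cls flip d).out) = 0 :=
        congrFun (LinearMap.mem_ker.1 hk) ⟨cls flip d, hd⟩
      rcases hout d with h2 | h2
      · rwa [← h2] at h1
      · have h3 : (cls flip d).out = flip d := by
          rw [← h.flip_flip (cls flip d).out, ← h2]
        rwa [← h2, h3, add_comm] at h1
    have hsum : ∑ d : D, c k d = 0 := by
      simp only [c, Finset.sum_add_distrib]
      rw [Equiv.sum_comp next k]
      exact CharTwo.add_self_eq_zero _
    have hinv : ∀ d, c k d + c k (flip d) = 0 := by
      have hr : c k r + c k (flip r) = 0 := by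
        rw [← hsum]
        have h1 : ∑ d ∈ Finset.univ \ {r, flip r}, c k d = 0 := by
          refine Finset.sum_involution (fun d _ => flip d) ?_ ?_ ?_ ?_
          · intro d hd
            apply hinv'
            intro hc
            simp only [Finset.mem_sdiff, Finset.mem_univ, true_and, Finset.mem_insert,
              Finset.mem_singleton, not_or] at hd
            rcases hout r with h2 | h2 <;> rcases hout d with h3 | h3 <;> rw [hc] at h3
            · exact hd.1 (h3.trans h2.symm)
            · rw [← h2] at h3; exact hd.2 h3
            · exact hd.2 (by rw [h2, h.flip_flip, h3])
            · exact hd.1 (h3.trans h2.symm)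
          · intro d _ _
            exact h.flip_ne d
          · intro d hd
            simp only [Finset.mem_sdiff, Finset.mem_univ, true_and, Finset.mem_insert,
              Finset.mem_singleton, not_or] at hd ⊢
            refine ⟨fun hc => hd.2 (by rw [← hc, h.flip_flip]), fun hc => hd.1 (flip.injective hc)⟩
          · intro d _
            exact h.flip_flip d
        rw [← Finset.sum_sdiff (Finset.subset_univ {r, flip r}), h1, zero_add,
          Finset.sum_pair (h.flip_ne r).symm]
      intro d
      by_cases hd : cls flip d = cls flip r
      · rcases hout r with h2 | h2 <;> rcases hout d with h3 | h3 <;> rw [hd] at h3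
        · rwa [h3, ← h2]
        · rw [← h2] at h3
          rw [h3, h.flip_flip, add_comm]; exact hr
        · have h4 : flip r = d := by rw [h2, h.flip_flip, h3]
          rw [← h4, h.flip_flip, add_comm]; exact hr
        · rwa [h3, ← h2]
      · exact hinv' d hd
    obtain ⟨f, hf⟩ := hex (c k) k (fun d => (htwo _ _ (hinv d)).symm) (fun d => by
      simp only [c]
      rw [add_comm, add_assoc, CharTwo.add_self_eq_zero, add_zero])
    have h1 : f ∈ cycleFunctions (next * flip) := by
      apply mem_cycleFunctions
      intro d
      rw [Equiv.Perm.mul_apply, (hf (flip d)).1, (hf d).2, htwo _ _ (hinv d), add_assoc,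
        CharTwo.add_self_eq_zero, add_zero]
    have h2 : k - f ∈ cycleFunctions next := by
      apply mem_cycleFunctions
      intro d
      have : k (next d) = k d + c k d := by
        simp only [c]
        rw [add_comm, add_assoc, CharTwo.add_self_eq_zero, add_zero]
      rw [Pi.sub_apply, Pi.sub_apply, (hf d).1, this]
      ring
    exact Submodule.mem_sup.2 ⟨f, h1, k - f, h2, by ring⟩
  have h1 := Submodule.finrank_mono hker
  have h2 := Submodule.finrank_sup_add_finrank_inf_eq (cycleFunctions (next * flip))
    (cycleFunctions next)
  have h3 : 1 ≤ Module.finrank (ZMod 2)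
      ((cycleFunctions (next * flip) ⊓ cycleFunctions next : Submodule (ZMod 2) (D → ZMod 2))) := by
    rw [Nat.one_le_iff_ne_zero]
    intro hc
    rw [Submodule.finrank_eq_zero] at hc
    have : (fun _ => 1 : D → ZMod 2) ∈ cycleFunctions (next * flip) ⊓ cycleFunctions next :=
      ⟨mem_cycleFunctions fun _ => rfl, mem_cycleFunctions fun _ => rfl⟩
    rw [hc] at this
    exact one_ne_zero (congrFun ((Submodule.mem_bot _).1 this) r)
  have h4 := finrank_cycleFunctions (next * flip)
  have h5 := finrank_cycleFunctions next
  omega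

lemma euler_of_exact [Finite D] (h : IsMap flip next) (r : D) (hex : Exact flip next) :
    numCycles (next * flip) + numCycles next = numCycles flip + 2 :=
  le_antisymm (h.euler_le r) (h.le_euler r hex)

end IsMap

end Maps

end Cogrowth

namespace Cogrowth

section CyclicLists

variable {D : Type}

/-- The list `l` is traversed cyclically by `next`. -/
def IsCyc (next : D → D) (l : List D) : Prop := l.map next = l.rotate 1

lemma IsCyc.rotate {next : D → D} {l : List D} (h : IsCyc next l) (n : ℕ) :
    IsCyc next (l.rotate n) := by
  unfold IsCyc at *
  rw [List.map_rotate, h, List.rotate_rotate, List.rotate_rotate, add_comm]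

lemma IsCyc.append_comm {next : D → D} {u v : List D} (h : IsCyc next (u ++ v)) :
    IsCyc next (v ++ u) := by
  have := h.rotate u.length
  rwa [List.rotate_append_length_eq] at this

lemma isCyc_cons {next : D → D} {x : D} {l : List D} :
    IsCyc next (x :: l) ↔ (x :: l).map next = l ++ [x] := by
  simp [IsCyc]

lemma eq_of_append_singleton_eq_cons {α : Type*} {a : α} {l : List α} (h : l ++ [a] = a :: l) :
    ∀ e ∈ l, e = a := by
  induction l with
  | nil => simp
  | cons b l ih =>
    simp only [List.cons_append, List.cons.injEq] at h
    obtain ⟨rfl, h⟩ := h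
    simpa using ih h

lemma IsCyc.eq_of_invariant {α : Type*} {next : D → D} {x : D} {l : List D}
    (h : IsCyc next (x :: l)) {g : D → α} (hg : ∀ d, g (next d) = g d) : ∀ e ∈ l, g e = g x := by
  have h1 : l.map g ++ [g x] = g x :: l.map g := by
    have := congrArg (List.map g) (isCyc_cons.1 h)
    rw [List.map_map, show g ∘ next = g from funext hg] at this
    simpa using this.symm
  intro e he
  exact eq_of_append_singleton_eq_cons h1 _ (List.mem_map_of_mem he)

lemma eq_map_range_iterate {next : D → D} {l : List D} {x z : D}
    (h : (x :: l).map next = l ++ [z]) :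
    x :: l = (List.range (l.length + 1)).map (fun i => next^[i] x) ∧
      next^[l.length + 1] x = z := by
  induction l generalizing x with
  | nil => simpa using h
  | cons y l ih =>
    simp only [List.map_cons, List.cons_append, List.cons.injEq] at h
    obtain ⟨rfl, h⟩ := h
    obtain ⟨h1, h2⟩ := ih (x := next x) (by simpa using h)
    refine ⟨?_, by simpa using h2⟩
    rw [List.length_cons, List.range_succ_eq_map (n := l.length + 1), List.map_cons, List.map_map]
    exact congrArg _ h1

lemma IsCyc.readCycle_eq {m : ℕ} {next : Equiv.Perm D} (label : D → Fin m × Bool) {x : D}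
    {l : List D} (h : IsCyc next (x :: l)) (hl : (x :: l).Nodup) :
    readCycle next label x = (x :: l).map label := by
  obtain ⟨h1, h2⟩ := eq_map_range_iterate (isCyc_cons.1 h)
  have hp : Function.minimalPeriod next x = l.length + 1 := by
    have hper : Function.IsPeriodicPt next (l.length + 1) x := h2
    refine le_antisymm (hper.minimalPeriod_le (by simp)) ?_
    by_contra hlt
    rw [not_le] at hlt
    rw [h1] at hl
    have := List.inj_on_of_nodup_map hl (List.mem_range.2 hlt) (List.mem_range.2 (Nat.succ_pos _))
      (by simp [Function.iterate_minimalPeriod])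
    exact (hper.minimalPeriod_pos (by simp)).ne' this
  rw [readCycle, hp, h1, List.map_map]
  rfl

lemma IsCyc.readCycle_isRotated {m : ℕ} {next : Equiv.Perm D} (label : D → Fin m × Bool) {x : D}
    {l : List D} (h : IsCyc next l) (hl : l.Nodup) (hx : x ∈ l) :
    readCycle next label x ~r l.map label := by
  obtain ⟨u, v, rfl⟩ := List.append_of_mem hx
  have h1 : IsCyc next (x :: (v ++ u)) := h.append_comm
  have h2 : (x :: (v ++ u)).Nodup := by
    rw [← List.cons_append]; exact List.nodup_append_comm.1 hl
  rw [h1.readCycle_eq label h2]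
  refine List.IsRotated.map ?_ label
  exact List.isRotated_append (l := x :: v) (l' := u)

end CyclicLists

section Surgery

variable {D : Type} [DecidableEq D]

lemma IsCyc.split {next : Equiv.Perm D} {x y : D} {s t : List D}
    (h : IsCyc next (x :: s ++ y :: t)) (hn : (x :: s ++ y :: t).Nodup) :
    IsCyc (next * Equiv.swap x y : Equiv.Perm D) (y :: s) ∧
      IsCyc (next * Equiv.swap x y : Equiv.Perm D) (x :: t) ∧
      (x :: s).map next = s ++ [y] ∧ (y :: t).map next = t ++ [x] := by
  rw [List.cons_append, isCyc_cons] at h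
  have h' : (x :: s).map next ++ (y :: t).map next = (s ++ [y]) ++ (t ++ [x]) := by
    simpa using h
  obtain ⟨h1, h2⟩ := List.append_inj h' (by simp)
  have hs : ∀ d ∈ s, (next * Equiv.swap x y : Equiv.Perm D) d = next d := by
    intro d hd
    simp only [List.cons_append, List.nodup_cons, List.mem_append, List.mem_cons,
      List.nodup_append] at hn
    rw [Equiv.Perm.mul_apply, Equiv.swap_apply_of_ne_of_ne]
    · rintro rfl; tauto
    · rintro rfl; exact hn.2.2.2 _ hd _ (Or.inl rfl) rfl
  have ht : ∀ d ∈ t, (next * Equiv.swap x y : Equiv.Perm D) d = next d := by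
    intro d hd
    simp only [List.cons_append, List.nodup_cons, List.mem_append, List.mem_cons,
      List.nodup_append] at hn
    rw [Equiv.Perm.mul_apply, Equiv.swap_apply_of_ne_of_ne]
    · rintro rfl; tauto
    · rintro rfl; tauto
  refine ⟨?_, ?_, h1, h2⟩
  · rw [isCyc_cons, ← h1]
    simp only [List.map_cons, List.cons.injEq]
    exact ⟨by simp, List.map_congr_left hs⟩
  · rw [isCyc_cons, ← h2]
    simp only [List.map_cons, List.cons.injEq]
    exact ⟨by simp, List.map_congr_left ht⟩

lemma Exact.split {flip next : Equiv.Perm D} {x y : D} {s t : List D} (hex : Exact flip next)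
    (h : IsCyc next (x :: s ++ y :: t)) (hn : (x :: s ++ y :: t).Nodup) :
    Exact flip (next * Equiv.swap x y : Equiv.Perm D) := by
  obtain ⟨-, -, h1, h2⟩ := h.split hn
  intro c k hc hk
  have hkx : k (next y) = k x + c x := by simpa using hk x
  have hky : k (next x) = k y + c y := by simpa using hk y
  have hk' : ∀ d, d ≠ x → d ≠ y → k (next d) = k d + c d := by
    intro d hdx hdy
    have := hk d
    rwa [Equiv.Perm.mul_apply, Equiv.swap_apply_of_ne_of_ne hdx hdy] at this
  have hmem : ∀ d, next d ∈ y :: s ↔ d ∈ x :: s := by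
    intro d
    have : next d ∈ s ++ [y] ↔ d ∈ x :: s := by
      rw [← h1]
      exact List.mem_map_of_injective next.injective
    rw [← this]; simp [or_comm]
  simp only [List.cons_append, List.nodup_cons, List.mem_append, List.mem_cons,
    List.nodup_append] at hn
  have hxy : x ≠ y := by rintro rfl; tauto
  have hxs : x ∉ y :: s := by simp only [List.mem_cons]; tauto
  have hys : y ∉ x :: s := by
    simp only [List.mem_cons]
    rintro (rfl | hy)
    · tauto
    · exact hn.2.2.2 _ hy _ (Or.inl rfl) rfl
  let κ := k (next x) - (k x + c x)
  let k' : D → ZMod 2 := fun d => if d ∈ y :: s then k d - κ else k d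
  obtain ⟨f, hf⟩ := hex c k' hc (by
    intro d
    simp only [k', hmem]
    by_cases hdx : d = x
    · subst hdx
      rw [if_pos (by simp), if_neg hxs]; simp only [κ]; ring
    by_cases hdy : d = y
    · subst hdy
      rw [if_neg hys, if_pos (by simp), hkx]; simp only [κ]; rw [hky]; ring
    have : d ∈ x :: s ↔ d ∈ y :: s := by simp [hdx, hdy]
    simp only [this, hk' d hdx hdy]
    split_ifs <;> ring)
  have hg : f y - k' y = f x - k' x := by
    rw [List.cons_append] at h
    refine h.eq_of_invariant (g := fun d => f d - k' d) ?_ y (by simp)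
    intro d
    have h3 : k' (next d) = k' d + c d := by
      simp only [k', hmem]
      by_cases hdx : d = x
      · subst hdx
        rw [if_pos (by simp), if_neg hxs]; simp only [κ]; ring
      by_cases hdy : d = y
      · subst hdy
        rw [if_neg hys, if_pos (by simp), hkx]; simp only [κ]; rw [hky]; ring
      have : d ∈ x :: s ↔ d ∈ y :: s := by simp [hdx, hdy]
      simp only [this, hk' d hdx hdy]
      split_ifs <;> ring
    rw [(hf d).1, h3]; ring
  have hfxy : f x + c x = f y + c y := by
    rw [show k' x = k x from if_neg hxs, show k' y = k y - κ from if_pos (by simp)] at hg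
    simp only [κ, hky] at hg
    linear_combination -hg
  refine ⟨f, fun d => ⟨?_, (hf d).2⟩⟩
  by_cases hdx : d = x
  · subst hdx
    simp [(hf y).1, hfxy]
  by_cases hdy : d = y
  · subst hdy
    simp [(hf x).1, hfxy]
  rw [Equiv.Perm.mul_apply, Equiv.swap_apply_of_ne_of_ne hdx hdy, (hf d).1]

/-- Collapse of a bigon. -/
lemma Exact.collapse {flip flip' next : Equiv.Perm D} {e₁ e₂ f₁ f₂ : D} (hex : Exact flip next)
    (hflip : ∀ d, flip (flip d) = d)
    (h₁ : next e₁ = e₂) (h₂ : next e₂ = e₁) (hf₁ : flip e₁ = f₁) (hf₂ : flip e₂ = f₂)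
    (hne : e₁ ≠ e₂) (hfe₁ : f₁ ≠ e₁) (hfe₂ : f₁ ≠ e₂) (hfe₃ : f₂ ≠ e₁) (hfe₄ : f₂ ≠ e₂)
    (he₁ : flip' e₁ = e₂) (he₂ : flip' e₂ = e₁) (hff₁ : flip' f₁ = f₂) (hff₂ : flip' f₂ = f₁)
    (hflip' : ∀ d, d ≠ e₁ → d ≠ e₂ → d ≠ f₁ → d ≠ f₂ → flip' d = flip d) :
    Exact flip' next := by
  have hf₁' : flip f₁ = e₁ := by rw [← hf₁, hflip]
  have hf₂' : flip f₂ = e₂ := by rw [← hf₂, hflip]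
  intro c k hc hk
  have hcf : c f₁ = c f₂ := by rw [← hc f₁, hff₁]
  have hce : c e₁ = c e₂ := by rw [← hc e₁, he₁]
  have hnext : ∀ d, d ≠ e₁ → d ≠ e₂ → next d ≠ e₁ ∧ next d ≠ e₂ := by
    intro d hd₁ hd₂
    rw [← h₁]
    nth_rewrite 1 [← h₂]
    exact ⟨fun hh => hd₂ (next.injective hh), fun hh => hd₁ (next.injective hh)⟩
  let c' : D → ZMod 2 := fun d => if d = e₁ ∨ d = e₂ then c f₁ else c d
  let k' : D → ZMod 2 := fun d => if d = e₁ then 0 else if d = e₂ then c f₁ else k d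
  obtain ⟨f, hf⟩ := hex c' k' (by
    intro d
    simp only [c']
    by_cases hd₁ : d = e₁
    · subst hd₁; simp [hf₁, hfe₁, hfe₂]
    by_cases hd₂ : d = e₂
    · subst hd₂; simp [hf₂, hfe₃, hfe₄, hcf]
    by_cases hd₃ : d = f₁
    · subst hd₃; simp [hf₁', hd₁, hd₂]
    by_cases hd₄ : d = f₂
    · subst hd₄; simp [hf₂', hd₁, hd₂, hcf]
    have h5 : flip d ≠ e₁ := fun hh => hd₃ (by rw [← hf₁, ← hh, hflip])
    have h6 : flip d ≠ e₂ := fun hh => hd₄ (by rw [← hf₂, ← hh, hflip])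
    simp only [h5, h6, hd₁, hd₂, or_self, if_false]
    rw [← hflip' d hd₁ hd₂ hd₃ hd₄, hc]) (by
    intro d
    simp only [k', c']
    by_cases hd₁ : d = e₁
    · subst hd₁; simp [h₁, hne.symm]
    by_cases hd₂ : d = e₂
    · subst hd₂; simp [h₂, hne.symm, CharTwo.add_self_eq_zero]
    obtain ⟨h3, h4⟩ := hnext d hd₁ hd₂
    simp [h3, h4, hd₁, hd₂, hk])
  have hcc : ∀ d, d ≠ e₁ → d ≠ e₂ → c' d = c d := by
    intro d hd₁ hd₂
    simp [c', hd₁, hd₂]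
  have hv₁ : f f₁ = f e₂ := by rw [← hf₁, (hf e₁).2, ← (hf e₁).1, h₁]
  have hv₂ : f f₂ = f e₂ + c f₁ := by rw [← hf₂, (hf e₂).2]; simp [c']
  refine ⟨fun d => if d = e₁ then 0 else if d = e₂ then c e₁ else f d, fun d => ?_⟩
  by_cases hd₁ : d = e₁
  · subst hd₁; simp [h₁, he₁, hne.symm]
  by_cases hd₂ : d = e₂
  · subst hd₂; simp [h₂, he₂, hne.symm, hce, CharTwo.add_self_eq_zero]
  obtain ⟨h3, h4⟩ := hnext d hd₁ hd₂
  refine ⟨by simp [h3, h4, hd₁, hd₂, (hf d).1, hcc], ?_⟩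
  by_cases hd₃ : d = f₁
  · subst hd₃; simp [hff₁, hd₁, hd₂, hfe₃, hfe₄, hv₁, hv₂]
  by_cases hd₄ : d = f₂
  · subst hd₄; simp [hff₂, hd₁, hd₂, hfe₁, hfe₂, hv₁, hv₂, hcf, add_assoc, CharTwo.add_self_eq_zero]
  have h5 : flip d ≠ e₁ := fun hh => hd₃ (by rw [← hf₁, ← hh, hflip])
  have h6 : flip d ≠ e₂ := fun hh => hd₄ (by rw [← hf₂, ← hh, hflip])
  rw [hflip' d hd₁ hd₂ hd₃ hd₄]
  simp [h5, h6, hd₁, hd₂, (hf d).2, hcc]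

/-- Attachment of a new edge in the corner after `y`. -/
lemma Exact.attach {flip next : Equiv.Perm D} (hex : Exact flip next) (y : D) :
    Exact (Equiv.sumCongr flip Equiv.boolNot)
      (Equiv.sumCongr next Equiv.boolNot * Equiv.swap (Sum.inr true) (Sum.inl y) :
        Equiv.Perm (D ⊕ Bool)) := by
  intro c k hc hk
  have hcb : c (Sum.inr true) = c (Sum.inr false) := by
    have := hc (Sum.inr false)
    simpa using this
  have hky : k (Sum.inr false) = k (Sum.inl y) + c (Sum.inl y) := by
    simpa using hk (Sum.inl y)
  have hkt : k (Sum.inl (next y)) = k (Sum.inr true) + c (Sum.inr true) := by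
    simpa using hk (Sum.inr true)
  have hkf : k (Sum.inr true) = k (Sum.inr false) + c (Sum.inr false) := by
    have := hk (Sum.inr false)
    rw [Equiv.Perm.mul_apply, Equiv.swap_apply_of_ne_of_ne (by simp) (by simp)] at this
    simpa using this
  have hkd : ∀ d, d ≠ y → k (Sum.inl (next d)) = k (Sum.inl d) + c (Sum.inl d) := by
    intro d hd
    have := hk (Sum.inl d)
    rw [Equiv.Perm.mul_apply, Equiv.swap_apply_of_ne_of_ne (by simp) (by simpa using hd)] at this
    simpa using this
  obtain ⟨f, hf⟩ := hex (fun d => c (Sum.inl d)) (fun d => k (Sum.inl d))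
    (fun d => by simpa using hc (Sum.inl d)) (fun d => by
      by_cases hd : d = y
      · subst hd
        rw [hkt, hkf, hky, hcb, add_assoc, CharTwo.add_self_eq_zero, add_zero]
      · exact hkd d hd)
  refine ⟨Sum.elim f fun b => f y + c (Sum.inl y) + if b then c (Sum.inr false) else 0, ?_⟩
  rintro (d | b)
  · refine ⟨?_, by simpa using (hf d).2⟩
    by_cases hd : d = y
    · subst hd; simp
    · rw [Equiv.Perm.mul_apply, Equiv.swap_apply_of_ne_of_ne (by simp) (by simpa using hd)]
      simpa using (hf d).1
  · cases b
    · rw [Equiv.Perm.mul_apply, Equiv.swap_apply_of_ne_of_ne (by simp) (by simp)]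
      simp
    · simp [(hf y).1, hcb, add_assoc, CharTwo.add_self_eq_zero]

end Surgery

end Cogrowth

namespace Cogrowth

section Prediagrams

variable {m : ℕ}

/-- The inverse letter. -/
def invLetter (a : Fin m × Bool) : Fin m × Bool := (a.1, !a.2)

@[simp] lemma invLetter_invLetter (a : Fin m × Bool) : invLetter (invLetter a) = a := by
  simp [invLetter]

/-- The word `w` is a cyclic permutation of a relator or of the inverse of one. -/
def IsRelator (R : Finset (Word m)) (w : Word m) : Prop :=
  ∃ r ∈ R, w ~r r ∨ w ~r FreeGroup.invRev r

/-- A possibly disconnected map with outer face `o`, all of whose connected components are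
spheres, and all of whose other faces bear relators or are bigons bounded by a single edge. -/
structure IsPrediagram (R : Finset (Word m)) {D : Type} (flip next : Equiv.Perm D)
    (label : D → Fin m × Bool) (o : List D) : Prop where
  flip_flip : ∀ d, flip (flip d) = d
  flip_ne : ∀ d, flip d ≠ d
  label_flip : ∀ d, label (flip d) = invLetter (label d)
  nodup : o.Nodup
  cyc : IsCyc next o
  face : ∀ d, d ∉ o → (next d = flip d ∧ next (flip d) = d ∧ flip d ∉ o) ∨
    ∃ l : List D, l.Nodup ∧ d ∈ l ∧ IsCyc next l ∧ (∀ e ∈ l, e ∉ o) ∧ IsRelator R (l.map label)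
  exact : Exact flip next

/-- The word `w` is the boundary word of a prediagram. -/
def Bounds (R : Finset (Word m)) (w : Word m) : Prop :=
  ∃ (D : Type) (_ : Fintype D) (flip next : Equiv.Perm D) (label : D → Fin m × Bool) (o : List D),
    IsPrediagram R flip next label o ∧ o.map label = w

variable {R : Finset (Word m)}

lemma Bounds.nil : Bounds R [] :=
  ⟨Empty, inferInstance, 1, 1, fun e => e.elim, [],
    ⟨fun e => e.elim, fun e => e.elim, fun e => e.elim, List.nodup_nil, by simp [IsCyc],
      fun e => e.elim, fun c k _ _ => ⟨k, fun e => e.elim⟩⟩, rfl⟩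

lemma Bounds.edge (a : Fin m × Bool) : Bounds R [a, invLetter a] := by
  refine ⟨Bool, inferInstance, Equiv.boolNot, Equiv.boolNot,
    fun b => if b then invLetter a else a, [false, true],
    ⟨by simp, by simp, by simp, by simp, by simp [IsCyc], by simp, ?_⟩, by simp⟩
  intro c k hc hk
  refine ⟨k, fun d => ⟨hk d, hk d⟩⟩

lemma Bounds.append_comm {u v : Word m} (h : Bounds R (u ++ v)) : Bounds R (v ++ u) := by
  obtain ⟨D, hD, flip, next, label, o, h, ho⟩ := h
  obtain ⟨o₁, o₂, rfl, rfl, rfl⟩ := List.map_eq_append_iff.1 ho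
  have hmem : ∀ d, d ∈ o₂ ++ o₁ ↔ d ∈ o₁ ++ o₂ := by simp [or_comm]
  refine ⟨D, hD, flip, next, label, o₂ ++ o₁,
    ⟨h.flip_flip, h.flip_ne, h.label_flip, List.nodup_append_comm.1 h.nodup, h.cyc.append_comm,
      ?_, h.exact⟩, by simp⟩
  simpa only [hmem] using h.face

lemma Bounds.attach_cons (a b : Fin m × Bool) {t : Word m} (h : Bounds R (b :: t)) :
    Bounds R (b :: a :: invLetter a :: t) := by
  classical
  obtain ⟨D, hD, flip, next, label, o, h, ho⟩ := h
  obtain ⟨y, s, rfl, rfl, rfl⟩ := List.map_eq_cons_iff.1 ho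
  set N : Equiv.Perm (D ⊕ Bool) := Equiv.sumCongr next Equiv.boolNot *
    Equiv.swap (Sum.inr true) (Sum.inl y) with hN
  have hNd : ∀ d, d ≠ y → N (Sum.inl d) = Sum.inl (next d) := by
    intro d hd
    rw [hN, Equiv.Perm.mul_apply, Equiv.swap_apply_of_ne_of_ne (by simp) (by simpa using hd)]
    simp
  have hNf : N (Sum.inr false) = Sum.inr true := by
    rw [hN, Equiv.Perm.mul_apply, Equiv.swap_apply_of_ne_of_ne (by simp) (by simp)]
    simp
  have hNt : N (Sum.inr true) = Sum.inl (next y) := by simp [hN]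
  have hNy : N (Sum.inl y) = Sum.inr false := by simp [hN]
  have hys : y ∉ s := (List.nodup_cons.1 h.nodup).1
  refine ⟨D ⊕ Bool, inferInstance, Equiv.sumCongr flip Equiv.boolNot, N,
    Sum.elim label fun b => if b then invLetter a else a,
    Sum.inl y :: Sum.inr false :: Sum.inr true :: s.map Sum.inl,
    ⟨?_, ?_, ?_, ?_, ?_, ?_, h.exact.attach y⟩, by simp⟩
  · rintro (d | b) <;> simp [h.flip_flip]
  · rintro (d | b)
    · simp [h.flip_ne]
    · cases b <;> simp
  · rintro (d | b)
    · simp [h.label_flip]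
    · cases b <;> simp
  · have := h.nodup
    simp only [List.nodup_cons] at this
    simp [this.1, List.nodup_map_iff Sum.inl_injective, this.2]
  · have hc := isCyc_cons.1 h.cyc
    rw [isCyc_cons]
    simp only [List.map_cons, hNy, hNf, hNt, List.cons_append, List.cons.injEq, true_and]
    have h1 : List.map N (s.map Sum.inl) = (s.map next).map Sum.inl := by
      rw [List.map_map, List.map_map]
      apply List.map_congr_left
      intro d hd
      exact hNd d (by rintro rfl; exact hys hd)
    rw [h1]
    have := congrArg (List.map (Sum.inl : D → D ⊕ Bool)) hc
    simpa using this
  · rintro (d | b) hd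
    · simp only [List.mem_cons, Sum.inl.injEq, reduceCtorEq, false_or, List.mem_map,
        exists_eq_right, not_or] at hd
      rcases h.face d (by simpa using hd) with ⟨h1, h2, h3⟩ | ⟨l, hl, hdl, hlc, hlo, hlr⟩
      · left
        simp only [List.mem_cons, not_or] at h3
        refine ⟨by rw [hNd d hd.1, h1]; simp, ?_, by simpa using h3⟩
        rw [Equiv.sumCongr_apply, Sum.map_inl, hNd _ h3.1, h2]
      · right
        refine ⟨l.map Sum.inl, hl.map Sum.inl_injective, by simpa using hdl, ?_, ?_, ?_⟩
        · unfold IsCyc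
          rw [← List.map_rotate, ← hlc, List.map_map, List.map_map]
          apply List.map_congr_left
          intro e he
          exact hNd e (by rintro rfl; exact hlo _ he (by simp))
        · intro e he
          obtain ⟨e, he', rfl⟩ := List.mem_map.1 he
          simpa using hlo e he'
        · simpa using hlr
    · exfalso; cases b <;> simp at hd

lemma Bounds.attach (a : Fin m × Bool) {u v : Word m} (h : Bounds R (u ++ v)) :
    Bounds R (u ++ a :: invLetter a :: v) := by
  have key : ∀ w : Word m, Bounds R w → Bounds R ((a :: invLetter a :: []) ++ w) := by
    intro w hw
    rcases List.eq_nil_or_concat' w with rfl | ⟨t, b, rfl⟩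
    · exact Bounds.edge a
    · have h1 : Bounds R ([b] ++ t) := Bounds.append_comm hw
      have h2 : Bounds R ([b] ++ (a :: invLetter a :: t)) := h1.attach_cons a b
      have := h2.append_comm
      simpa using this
  have := key _ h.append_comm
  rw [← List.append_assoc] at this
  exact this.append_comm

/-- The outer face may be cut along a relator. -/
lemma Bounds.pinch {s t : Word m} (h : Bounds R (s ++ t)) (hs : IsRelator R s) : Bounds R t := by
  classical
  rcases List.eq_nil_or_concat' s with rfl | ⟨s₀, b, rfl⟩
  · exact h
  rcases List.eq_nil_or_concat' t with rfl | ⟨t₀, c, rfl⟩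
  · exact Bounds.nil
  have h1 : Bounds R (c :: ((s₀ ++ [b]) ++ t₀)) := by
    apply Bounds.append_comm (v := [c])
    simpa using h
  clear h
  apply Bounds.append_comm (u := [c])
  obtain ⟨D, hD, flip, next, label, o, h, ho⟩ := h1
  obtain ⟨x, o₁, rfl, rfl, ho₁⟩ := List.map_eq_cons_iff.1 ho
  obtain ⟨o₂, t₁, rfl, ho₂, rfl⟩ := List.map_eq_append_iff.1 ho₁
  obtain ⟨s₁, y', rfl, rfl, hy⟩ := List.map_eq_append_iff.1 ho₂
  obtain ⟨y, _, rfl, rfl, hy'⟩ := List.map_eq_cons_iff.1 hy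
  obtain rfl := List.map_eq_nil_iff.1 hy'
  have e1 : x :: (s₁ ++ [y] ++ t₁) = x :: s₁ ++ y :: t₁ := by simp
  have hcyc := h.cyc
  have hnodup := h.nodup
  rw [e1] at hcyc hnodup
  obtain ⟨hc1, hc2, -, -⟩ := hcyc.split hnodup
  have hN : ∀ d, d ∉ x :: s₁ ++ y :: t₁ →
      (next * Equiv.swap x y : Equiv.Perm D) d = next d := by
    intro d hd
    rw [Equiv.Perm.mul_apply, Equiv.swap_apply_of_ne_of_ne]
    · rintro rfl; simp at hd
    · rintro rfl; simp at hd
  refine ⟨D, hD, flip, next * Equiv.swap x y, label, x :: t₁,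
    ⟨h.flip_flip, h.flip_ne, h.label_flip, ?_, hc2, ?_, h.exact.split hcyc hnodup⟩, by simp⟩
  · refine hnodup.sublist ?_
    simp
  · intro d hd
    by_cases hd' : d ∈ x :: s₁ ++ y :: t₁
    · right
      refine ⟨y :: s₁, ?_, ?_, hc1, ?_, ?_⟩
      · have h3 : (s₁ ++ [y]).Nodup := hnodup.sublist (by simp)
        exact List.nodup_append_comm.1 h3
      · simp only [List.cons_append, List.mem_cons, List.mem_append] at hd hd' ⊢
        tauto
      · simp only [List.cons_append, List.nodup_cons, List.nodup_append, List.mem_cons,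
          List.mem_append] at hnodup ⊢
        rintro e (rfl | he) (rfl | he')
        · tauto
        · tauto
        · tauto
        · exact hnodup.2.2.2 _ he _ (Or.inr he') rfl
      · obtain ⟨r, hr, hrr⟩ := hs
        have h4 : (y :: s₁).map label ~r List.map label s₁ ++ List.map label [y] := by
          have := List.isRotated_append (l := [label y]) (l' := s₁.map label)
          simpa using this
        exact ⟨r, hr, hrr.imp h4.trans h4.trans⟩
    · have hsub : ∀ e, e ∈ x :: t₁ → e ∈ x :: s₁ ++ y :: t₁ := by
        intro e he
        simp only [List.cons_append, List.mem_cons, List.mem_append] at he ⊢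
        tauto
      rcases h.face d (by rwa [e1]) with ⟨h5, h6, h7⟩ | ⟨l, hl, hdl, hlc, hlo, hlr⟩
      · left
        rw [e1] at h7
        exact ⟨by rw [hN d hd', h5], by rw [hN _ h7, h6], fun hc => h7 (hsub _ hc)⟩
      · right
        rw [e1] at hlo
        refine ⟨l, hl, hdl, ?_, fun e he hc => hlo e he (hsub _ hc), hlr⟩
        unfold IsCyc
        rw [← hlc]
        exact List.map_congr_left fun e he => hN e (hlo e he)

/-- Two consecutive inverse edges of the outer face may be glued. -/
lemma Bounds.glue {a : Fin m × Bool} {t : Word m} (h : Bounds R (a :: invLetter a :: t)) :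
    Bounds R t := by
  classical
  rcases List.eq_nil_or_concat' t with rfl | ⟨t₀, c, rfl⟩
  · exact Bounds.nil
  have h1 : Bounds R (c :: a :: invLetter a :: t₀) := by
    apply Bounds.append_comm (v := [c])
    simpa using h
  clear h
  apply Bounds.append_comm (u := [c])
  obtain ⟨D, hD, flip, next, label, o, h, ho⟩ := h1
  obtain ⟨x, o₁, rfl, rfl, ho₁⟩ := List.map_eq_cons_iff.1 ho
  obtain ⟨z, o₂, rfl, rfl, ho₂⟩ := List.map_eq_cons_iff.1 ho₁
  obtain ⟨y, t₁, rfl, hlab, rfl⟩ := List.map_eq_cons_iff.1 ho₂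
  have hcyc : IsCyc next (x :: [z] ++ y :: t₁) := h.cyc
  have hnodup : (x :: [z] ++ y :: t₁).Nodup := h.nodup
  have hface := h.face
  have hmem : ∀ e, e ∈ x :: z :: y :: t₁ ↔ (e = x ∨ e = z ∨ e = y ∨ e ∈ t₁) := by simp
  obtain ⟨hc1, hc2, hm1, hm2⟩ := hcyc.split hnodup
  have hN : ∀ d, d ∉ x :: z :: y :: t₁ →
      (next * Equiv.swap x y : Equiv.Perm D) d = next d := by
    intro d hd
    rw [Equiv.Perm.mul_apply, Equiv.swap_apply_of_ne_of_ne]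
    · rintro rfl; simp at hd
    · rintro rfl; simp at hd
  have hexN : Exact flip (next * Equiv.swap x y : Equiv.Perm D) := h.exact.split hcyc hnodup
  have hyz : (next * Equiv.swap x y : Equiv.Perm D) y = z ∧
      (next * Equiv.swap x y : Equiv.Perm D) z = y := by
    have := isCyc_cons.1 hc1
    simpa using this
  set N : Equiv.Perm D := next * Equiv.swap x y
  have hzy : z ≠ y := by
    rintro rfl; simp at hnodup
  have hfz : ∀ d, flip d = z ↔ d = flip z :=
    fun d => ⟨fun hh => by rw [← hh, h.flip_flip], fun hh => by rw [hh, h.flip_flip]⟩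
  let flip' : Equiv.Perm D := Equiv.swap y (flip z) * flip * Equiv.swap y (flip z)
  have hflip' : ∀ d, d ≠ z → d ≠ y → d ≠ flip z → d ≠ flip y → flip' d = flip d := by
    intro d h1 h2 h3 h4
    have h5 : flip d ≠ y := by rintro rfl; exact h4 (h.flip_flip d).symm
    have h6 : flip d ≠ flip z := fun hh => h1 (flip.injective hh)
    simp only [flip', Equiv.Perm.mul_apply]
    rw [Equiv.swap_apply_of_ne_of_ne h2 h3, Equiv.swap_apply_of_ne_of_ne h5 h6]
  have hz' : flip' z = y := by
    simp only [flip', Equiv.Perm.mul_apply]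
    rw [Equiv.swap_apply_of_ne_of_ne hzy (h.flip_ne z).symm, Equiv.swap_apply_right]
  have hff : ∀ d, flip' (flip' d) = d := by
    intro d
    simp [flip', h.flip_flip]
  have hy' : flip' y = z := by rw [← hz', hff]
  have hfz' : flip' (flip z) = flip y ∨ flip z = y := by
    by_cases hc : flip z = y
    · exact Or.inr hc
    left
    simp only [flip', Equiv.Perm.mul_apply]
    rw [Equiv.swap_apply_right, Equiv.swap_apply_of_ne_of_ne (h.flip_ne y)]
    intro hh
    exact hzy (flip.injective hh).symm
  refine ⟨D, hD, flip', N, label, x :: t₁, ⟨hff, ?_, ?_, ?_, hc2, ?_, ?_⟩, by simp⟩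
  · intro d hd
    simp only [flip', Equiv.Perm.mul_apply] at hd
    rw [Equiv.swap_apply_eq_iff] at hd
    exact h.flip_ne _ hd
  · intro d
    by_cases h1 : d = z
    · subst h1; rw [hz', hlab]
    by_cases h2 : d = y
    · subst h2; rw [hy', hlab, invLetter_invLetter]
    rcases hfz' with hfz' | hfz'
    · have hfy' : flip' (flip y) = flip z := by rw [← hfz', hff]
      by_cases h3 : d = flip z
      · rw [h3, hfz', h.label_flip, h.label_flip, hlab]
      by_cases h4 : d = flip y
      · rw [h4, hfy', h.label_flip, h.label_flip, hlab]; simp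
      rw [hflip' d h1 h2 h3 h4, h.label_flip]
    · rw [hflip' d h1 h2 (by rwa [hfz']) (by rw [← hfz', h.flip_flip]; exact h1), h.label_flip]
  · exact hnodup.sublist (by simp)
  · intro d hd
    by_cases hd' : d ∈ x :: z :: y :: t₁
    · left
      simp only [List.nodup_cons, List.mem_cons, List.cons_append, List.nil_append] at hnodup
      rcases (hmem d).1 hd' with rfl | rfl | rfl | h2
      · simp at hd
      · rw [hz', hyz.1, hyz.2]
        refine ⟨rfl, rfl, ?_⟩
        simp only [List.mem_cons]; tauto
      · rw [hy', hyz.1, hyz.2]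
        refine ⟨rfl, rfl, ?_⟩
        simp only [List.mem_cons]; tauto
      · simp [h2] at hd
    · have hsub : ∀ e, e ∈ x :: t₁ → e ∈ x :: z :: y :: t₁ := by
        intro e he
        rw [hmem]
        simp only [List.mem_cons] at he
        tauto
      rcases hface d hd' with ⟨h5, h6, h7⟩ | ⟨l, hl, hdl, hlc, hlo, hlr⟩
      · left
        have h8 : flip' d = flip d := by
          apply hflip'
          · rintro rfl; simp at hd'
          · rintro rfl; simp at hd'
          · rintro rfl; rw [h.flip_flip] at h7; simp at h7
          · rintro rfl; rw [h.flip_flip] at h7; simp at h7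
        rw [h8]
        exact ⟨by rw [hN d hd', h5], by rw [hN _ h7, h6], fun hc => h7 (hsub _ hc)⟩
      · right
        refine ⟨l, hl, hdl, ?_, fun e he hc => hlo e he (hsub _ hc), hlr⟩
        unfold IsCyc
        rw [← hlc]
        exact List.map_congr_left fun e he => hN e (hlo e he)
  · by_cases hc : flip z = y
    · have : flip' = flip := by ext d; simp [flip', hc]
      rw [this]; exact hexN
    · have hfz'' := hfz'.resolve_right hc
      refine hexN.collapse h.flip_flip hyz.2 hyz.1 rfl rfl hzy (h.flip_ne z) hc ?_ (h.flip_ne y)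
        hz' hy' hfz'' (by rw [← hfz'', hff]) hflip'
      intro hh
      exact hc (by rw [← hh, h.flip_flip])

end Prediagrams

end Cogrowth

namespace Cogrowth

section Existence

variable {m : ℕ} {R : Finset (Word m)}

lemma Bounds.glue_middle {a : Fin m × Bool} {u v : Word m}
    (h : Bounds R (u ++ a :: invLetter a :: v)) : Bounds R (u ++ v) := by
  have h1 : Bounds R (a :: invLetter a :: (v ++ u)) := h.append_comm
  exact h1.glue.append_comm

lemma bounds_iff_of_step {s t : Word m} (h : FreeGroup.Red.Step s t) (u v : Word m) :
    Bounds R (u ++ s ++ v) ↔ Bounds R (u ++ t ++ v) := by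
  cases h with
  | @not L₁ L₂ x b =>
    have e1 : u ++ (L₁ ++ (x, b) :: (x, !b) :: L₂) ++ v
        = (u ++ L₁) ++ (x, b) :: invLetter (x, b) :: (L₂ ++ v) := by simp [invLetter]
    have e2 : u ++ (L₁ ++ L₂) ++ v = (u ++ L₁) ++ (L₂ ++ v) := by simp
    rw [e1, e2]
    exact ⟨fun h => h.glue_middle, fun h => h.attach _⟩

lemma bounds_iff_of_red {s t : Word m} (h : FreeGroup.Red s t) (u v : Word m) :
    Bounds R (u ++ s ++ v) ↔ Bounds R (u ++ t ++ v) := by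
  induction h with
  | refl => rfl
  | tail _ h ih => exact ih.trans (bounds_iff_of_step h u v)

lemma bounds_iff_of_mk_eq {s t : Word m} (h : FreeGroup.mk s = FreeGroup.mk t) (u v : Word m) :
    Bounds R (u ++ s ++ v) ↔ Bounds R (u ++ t ++ v) := by
  obtain ⟨c, hs, ht⟩ := FreeGroup.Red.exact.1 h
  exact (bounds_iff_of_red hs u v).trans (bounds_iff_of_red ht u v).symm

variable (R) in
/-- Words representing `x` can be deleted from boundary words. -/
def Deletable (x : FreeGroup (Fin m)) : Prop :=
  ∀ s u v : Word m, FreeGroup.mk s = x → Bounds R (u ++ s ++ v) → Bounds R (u ++ v)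

lemma Deletable.one : Deletable R (1 : FreeGroup (Fin m)) := by
  intro s u v hs h
  have := (bounds_iff_of_mk_eq (t := []) (by rw [hs]; rfl) u v).1 h
  simpa using this

lemma Deletable.mul {x y : FreeGroup (Fin m)} (hx : Deletable R x) (hy : Deletable R y) :
    Deletable R (x * y) := by
  intro s u v hs h
  have h1 := (bounds_iff_of_mk_eq (t := x.toWord ++ y.toWord)
    (by rw [hs, ← FreeGroup.mul_mk, FreeGroup.mk_toWord, FreeGroup.mk_toWord]) u v).1 h
  have h2 : Bounds R (u ++ x.toWord ++ (y.toWord ++ v)) := by simpa using h1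
  have h3 := hx _ _ _ FreeGroup.mk_toWord h2
  rw [← List.append_assoc] at h3
  exact hy _ _ _ FreeGroup.mk_toWord h3

lemma Deletable.conj {x : FreeGroup (Fin m)} (hx : Deletable R x) (g : FreeGroup (Fin m)) :
    Deletable R (g * x * g⁻¹) := by
  intro s u v hs h
  have h1 := (bounds_iff_of_mk_eq (t := g.toWord ++ x.toWord ++ g⁻¹.toWord)
    (by rw [hs, ← FreeGroup.mul_mk, ← FreeGroup.mul_mk]; simp only [FreeGroup.mk_toWord]) u v).1 h
  have h2 : Bounds R ((u ++ g.toWord) ++ x.toWord ++ (g⁻¹.toWord ++ v)) := by simpa using h1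
  have h3 := hx _ _ _ FreeGroup.mk_toWord h2
  have h4 : Bounds R (u ++ (g.toWord ++ g⁻¹.toWord) ++ v) := by simpa using h3
  refine Deletable.one _ _ _ ?_ h4
  rw [← FreeGroup.mul_mk, FreeGroup.mk_toWord, FreeGroup.mk_toWord, mul_inv_cancel]

lemma Deletable.of_isRelator {r : Word m} (hr : IsRelator R r) :
    Deletable R (FreeGroup.mk r) := by
  intro s u v hs h
  have h1 := (bounds_iff_of_mk_eq (t := r) hs u v).1 h
  rw [List.append_assoc] at h1
  have h2 := h1.append_comm
  rw [List.append_assoc] at h2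
  exact (h2.pinch hr).append_comm

variable (R) in
/-- The normal subgroup of the elements that can be deleted along with their inverses. -/
def deletableSubgroup : Subgroup (FreeGroup (Fin m)) where
  carrier := {x | Deletable R x ∧ Deletable R x⁻¹}
  one_mem' := ⟨Deletable.one, by simpa using Deletable.one⟩
  mul_mem' := fun ha hb => ⟨ha.1.mul hb.1, by simpa using hb.2.mul ha.2⟩
  inv_mem' := fun ha => ⟨ha.2, by simpa using ha.1⟩

lemma deletableSubgroup_normal : (deletableSubgroup R).Normal where
  conj_mem := fun x hx g => ⟨hx.1.conj g, by simpa [mul_assoc] using hx.2.conj g⟩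

lemma Bounds.of_eval_eq_one {w : Word m} (hw : eval R w = 1) : Bounds R w := by
  have h1 : FreeGroup.mk w ∈ deletableSubgroup R := by
    have h2 : FreeGroup.mk w ∈ Subgroup.normalClosure
        ((fun r : Word m => FreeGroup.mk r) '' (R : Set (Word m))) :=
      (QuotientGroup.eq_one_iff _).1 hw
    have := deletableSubgroup_normal (R := R)
    refine Subgroup.normalClosure_le_normal ?_ h2
    rintro _ ⟨r, hr, rfl⟩
    refine ⟨Deletable.of_isRelator ⟨r, hr, Or.inl (List.IsRotated.refl _)⟩, ?_⟩
    rw [FreeGroup.inv_mk]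
    exact Deletable.of_isRelator ⟨r, hr, Or.inr (List.IsRotated.refl _)⟩
  have h2 : Bounds R ([] ++ (w ++ FreeGroup.invRev w) ++ []) := by
    refine (bounds_iff_of_mk_eq (t := []) ?_ [] []).2 (by simpa using Bounds.nil)
    rw [← FreeGroup.mul_mk, ← FreeGroup.inv_mk, mul_inv_cancel]
    rfl
  have h3 : Bounds R (w ++ FreeGroup.invRev w ++ []) := by simpa using h2
  have := h1.2 (FreeGroup.invRev w) w [] (by rw [FreeGroup.inv_mk]) h3
  simpa using this

/-- The diagram that consists of a single vertex. -/
def pointDiagram (R : Finset (Word m)) : VanKampenDiagram R where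
  Dart := Empty
  flip := 1
  next := 1
  flip_flip := fun e => e.elim
  flip_ne := fun e => e.elim
  connected := fun e => e.elim
  euler := fun ⟨e⟩ => e.elim
  label := fun e => e.elim
  label_flip := fun e => e.elim
  root := none
  root_eq_none := iff_of_true rfl inferInstance
  face_relator := fun e => e.elim

/-- The boundary word of a prediagram is that of the diagram formed by a component. -/
lemma IsPrediagram.exists_diagram {D : Type} [Fintype D] {flip next : Equiv.Perm D}
    {label : D → Fin m × Bool} {a : D} {o : List D}
    (h : IsPrediagram R flip next label (a :: o)) :
    ∃ Δ : VanKampenDiagram R, Δ.boundaryWord = (a :: o).map label := by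
  classical
  let C : D → Prop := fun d => ∃ g ∈ Subgroup.closure {flip, next}, g a = d
  have hmulC : ∀ s ∈ Subgroup.closure {flip, next}, ∀ d, C (s d) ↔ C d := by
    intro s hs d
    constructor
    · rintro ⟨g, hg, hgd⟩
      exact ⟨s⁻¹ * g, mul_mem (inv_mem hs) hg, by simp [hgd]⟩
    · rintro ⟨g, hg, rfl⟩
      exact ⟨s * g, mul_mem hs hg, rfl⟩
  have hflipC : ∀ d, C (flip d) ↔ C d := hmulC _ (Subgroup.subset_closure (by simp))
  have hnextC : ∀ d, C (next d) ↔ C d := hmulC _ (Subgroup.subset_closure (by simp))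
  have hCa : C a := ⟨1, one_mem _, rfl⟩
  let F : Equiv.Perm {d // C d} := flip.subtypePerm hflipC
  let N : Equiv.Perm {d // C d} := next.subtypePerm hnextC
  have hmap : IsMap F N := by
    refine ⟨fun d => Subtype.ext (h.flip_flip d), fun d hd => h.flip_ne d (congrArg Subtype.val hd),
      ?_⟩
    have key : ∀ g ∈ Subgroup.closure {flip, next}, ∀ d : {d // C d}, ∃ g' ∈ Subgroup.closure {F, N},
        (g' d : D) = g d := by
      intro g hg
      induction hg using Subgroup.closure_induction with
      | mem x hx =>
        intro d
        rcases hx with rfl | rfl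
        · exact ⟨F, Subgroup.subset_closure (by simp), rfl⟩
        · exact ⟨N, Subgroup.subset_closure (by simp), rfl⟩
      | one => exact fun d => ⟨1, one_mem _, rfl⟩
      | mul x y _ _ hx hy =>
        intro d
        obtain ⟨g₁, hg₁, h₁⟩ := hy d
        obtain ⟨g₂, hg₂, h₂⟩ := hx (g₁ d)
        exact ⟨g₂ * g₁, mul_mem hg₂ hg₁, by simp [h₁, h₂]⟩
      | inv x hx' hx =>
        intro d
        obtain ⟨g, hg, hgd⟩ := hx ⟨x⁻¹ d, (hmulC _ (inv_mem hx') d).2 d.2⟩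
        refine ⟨g⁻¹, inv_mem hg, ?_⟩
        have : g ⟨x⁻¹ d, (hmulC _ (inv_mem hx') d).2 d.2⟩ = d := Subtype.ext (by rw [hgd]; simp)
        conv_lhs => rw [← this]
        simp
    intro d e
    obtain ⟨g, hg, hgd⟩ := d.2
    obtain ⟨k, hk, hke⟩ := e.2
    obtain ⟨g', hg', h'⟩ := key (k * g⁻¹) (mul_mem hk (inv_mem hg)) d
    refine ⟨g', hg', Subtype.ext ?_⟩
    rw [h', ← hgd, ← hke]
    simp
  have hexact : Exact F N := by
    intro c k hc hk
    obtain ⟨f, hf⟩ := h.exact (fun d => if hd : C d then c ⟨d, hd⟩ else 0)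
      (fun d => if hd : C d then k ⟨d, hd⟩ else 0)
      (fun d => by
        by_cases hd : C d
        · rw [dif_pos hd, dif_pos ((hflipC d).2 hd)]; exact hc ⟨d, hd⟩
        · rw [dif_neg hd, dif_neg (fun hh => hd ((hflipC d).1 hh))])
      (fun d => by
        by_cases hd : C d
        · rw [dif_pos hd, dif_pos hd, dif_pos ((hnextC d).2 hd)]; exact hk ⟨d, hd⟩
        · rw [dif_neg hd, dif_neg hd, dif_neg (fun hh => hd ((hnextC d).1 hh)), add_zero])
    refine ⟨fun d => f d, fun d => ?_⟩
    have := hf d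
    rwa [dif_pos d.2] at this
  have hlift : ∀ l : List D, IsCyc next l → ∀ e ∈ l, C e →
      ∃ l' : List {d // C d}, l'.map Subtype.val = l ∧ IsCyc N l' := by
    intro l hl e he hCe
    have hCl : ∀ d ∈ l, C d := by
      obtain ⟨u, v, rfl⟩ := List.append_of_mem he
      have h1 : IsCyc next (e :: (v ++ u)) := hl.append_comm
      have h2 := h1.eq_of_invariant (g := C) (fun d => propext (hnextC d))
      intro d hd
      by_cases hde : d = e
      · rwa [hde]
      · rw [h2 d (by simp only [List.mem_append, List.mem_cons] at hd ⊢; tauto)]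
        exact hCe
    lift l to List {d // C d} using hCl
    refine ⟨l, rfl, ?_⟩
    unfold IsCyc at hl ⊢
    rw [List.map_map, ← List.map_rotate] at hl
    apply List.map_injective_iff.2 Subtype.val_injective
    rw [← hl, List.map_map]
    rfl
  obtain ⟨o', ho', hcyc⟩ := hlift _ h.cyc a (by simp) hCa
  obtain ⟨a', o', rfl, -, -⟩ := List.map_eq_cons_iff.1 ho'
  have hnodup : (a' :: o').Nodup := by
    have := h.nodup
    rw [← ho'] at this
    exact this.of_map
  let Δ : VanKampenDiagram R :=
    { Dart := {d // C d}
      fintypeDart := inferInstance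
      flip := F
      next := N
      flip_flip := hmap.flip_flip
      flip_ne := hmap.flip_ne
      connected := hmap.connected
      euler := fun _ => hmap.euler_of_exact a' hexact
      label := fun d => label d
      label_flip := fun d => h.label_flip d
      root := some a'
      root_eq_none := by
        simp only [reduceCtorEq, false_iff, not_isEmpty_iff]
        exact ⟨a'⟩
      face_relator := by
        intro d hd
        have hd' := hd a' rfl
        have hdo : (d : D) ∉ a :: o := by
          rw [← ho', List.mem_map_of_injective Subtype.val_injective]
          intro hmem
          have := hcyc.eq_of_invariant (g := cls N) (fun d => cls_apply d)
          rcases List.mem_cons.1 hmem with rfl | hmem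
          · exact hd' (Equiv.Perm.SameCycle.refl _ _)
          · exact hd' (cls_eq_iff.1 (this d hmem).symm)
        rcases h.face d hdo with ⟨h1, h2, h3⟩ | ⟨l, hl, hdl, hlc, -, r, hr, hlr⟩
        · exfalso
          obtain ⟨g, hg, hgd⟩ := d.2
          have := closure_invariant (f := fun e => e = d.1 ∨ e = flip d.1)
            (fun e => by
              apply propext
              constructor
              · rintro (hh | hh)
                · right; rw [← hh, h.flip_flip]
                · left; exact flip.injective hh
              · rintro (rfl | rfl)
                · right; rfl
                · left; exact h.flip_flip _)
            (fun e => by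
              apply propext
              constructor
              · rintro (hh | hh)
                · right; exact next.injective (by rw [hh, h2])
                · left; exact next.injective (by rw [hh, h1])
              · rintro (rfl | rfl)
                · right; exact h1
                · left; exact h2) hg a
          rw [hgd] at this
          have h4 : a = d.1 ∨ a = flip d.1 := this ▸ Or.inl rfl
          rcases h4 with h4 | h4
          · exact hdo (by simp [h4])
          · exact h3 (by simp [h4])
        · obtain ⟨l, rfl, hlN⟩ := hlift l hlc d hdl d.2
          have hdl' : d ∈ l := by
            rwa [List.mem_map_of_injective Subtype.val_injective] at hdl
          have h5 := hlN.readCycle_isRotated (fun d => label d.1) hl.of_map hdl'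
          rw [List.map_map] at hlr
          exact ⟨r, hr, hlr.imp h5.trans h5.trans⟩ }
  refine ⟨Δ, ?_⟩
  have := hcyc.readCycle_eq (fun d => label d.1) hnodup
  change readCycle N (fun d => label d.1) a' = _
  rw [this, ← ho', List.map_map]
  rfl

/-- Van Kampen's lemma. -/
theorem exists_diagram {w : Word m} (hw : eval R w = 1) :
    ∃ Δ : VanKampenDiagram R, Δ.boundaryWord = w := by
  obtain ⟨D, hD, flip, next, label, o, h, rfl⟩ := Bounds.of_eval_eq_one hw
  cases o with
  | nil => exact ⟨pointDiagram R, rfl⟩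
  | cons a o => exact h.exists_diagram

theorem exists_minimal_diagram {w : Word m} (hw : eval R w = 1) :
    ∃ Δ : VanKampenDiagram R, Δ.boundaryWord = w ∧ Δ.IsMinimal := by
  classical
  have hex : ∃ n, ∃ Δ : VanKampenDiagram R, Δ.boundaryWord = w ∧ Δ.area = n := by
    obtain ⟨Δ, hΔ⟩ := exists_diagram hw
    exact ⟨_, Δ, hΔ, rfl⟩
  obtain ⟨Δ, hΔ, harea⟩ := Nat.find_spec hex
  refine ⟨Δ, hΔ, fun Δ' hΔ' => ?_⟩
  rw [harea]
  exact Nat.find_min' hex ⟨Δ', hΔ'.trans hΔ, rfl⟩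

end Existence

end Cogrowth

namespace Cogrowth

section CycleSums

variable {D : Type}

lemma sameCycle_iterate (σ : Equiv.Perm D) (o : D) (i : ℕ) : σ.SameCycle o (σ^[i] o) :=
  ⟨i, by simp [Equiv.Perm.iterate_eq_pow]⟩

variable [Fintype D]

lemma SameCycle.exists_iterate {σ : Equiv.Perm D} {o d : D} (h : σ.SameCycle o d) :
    ∃ i < Function.minimalPeriod σ o, σ^[i] o = d := by
  obtain ⟨i, rfl⟩ := h.exists_nat_pow_eq
  refine ⟨i % Function.minimalPeriod σ o, Nat.mod_lt _ ?_, ?_⟩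
  · exact Function.minimalPeriod_pos_of_mem_periodicPts
      (Function.Injective.mem_periodicPts σ.injective o)
  · rw [Function.iterate_mod_minimalPeriod_eq, Equiv.Perm.iterate_eq_pow]

open Classical in
lemma sum_cycle {M : Type*} [AddCommMonoid M] (σ : Equiv.Perm D) (o : D) (f : D → M) :
    ∑ d with cls σ d = cls σ o, f d =
      ∑ i ∈ Finset.range (Function.minimalPeriod σ o), f (σ^[i] o) := by
  symm
  refine Finset.sum_bij (fun i _ => σ^[i] o) ?_ ?_ ?_ ?_
  · intro i _
    simpa using cls_eq_iff.2 (sameCycle_iterate σ o i).symm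
  · intro i hi j hj hij
    exact (Function.iterate_eq_iterate_iff_of_lt_minimalPeriod (Finset.mem_range.1 hi)
      (Finset.mem_range.1 hj)).1 hij
  · intro d hd
    obtain ⟨i, hi, rfl⟩ := SameCycle.exists_iterate
      (cls_eq_iff.1 (Finset.mem_filter.1 hd).2).symm
    exact ⟨i, Finset.mem_range.2 hi, rfl⟩
  · intros; rfl

/-- A function with values in a group can be integrated along the cycles of a permutation on which
its product is trivial. -/
lemma exists_primitive {G : Type*} [Group G] (σ : Equiv.Perm D) (l : D → G) :
    ∃ k : D → G, ∀ d, (∀ e, σ.SameCycle e d →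
      ((List.range (Function.minimalPeriod σ e)).map fun i => l (σ^[i] e)).prod = 1) →
        k (σ d) = k d * l d := by
  let P : D → ℕ → G := fun e i => ((List.range i).map fun i => l (σ^[i] e)).prod
  have hadd : ∀ e i j, P e (i + j) = P e i * P (σ^[i] e) j := by
    intro e i j
    induction j with
    | zero => simp [P]
    | succ j ih =>
      rw [← add_assoc]
      have h1 : ∀ e n, P e (n + 1) = P e n * l (σ^[n] e) := fun e n => by
        simp only [P]; rw [List.prod_range_succ]
      rw [h1, h1, ih, ← Function.iterate_add_apply, add_comm j i, mul_assoc]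
  have hrep : ∀ d, ∃ i, σ^[i] (cls σ d).out = d := by
    intro d
    obtain ⟨i, -, hi⟩ := SameCycle.exists_iterate (cls_eq_iff.1 (Quotient.out_eq (cls σ d)))
    exact ⟨i, hi⟩
  choose n hn using hrep
  refine ⟨fun d => P (cls σ d).out (n d), fun d hd => ?_⟩
  simp only [cls_apply]
  have hsd := hn (σ d)
  rw [cls_apply] at hsd
  have hd1 := hn d
  have hper := hd (cls σ d).out (cls_eq_iff.1 (Quotient.out_eq (cls σ d)))
  set e := (cls σ d).out
  have hP : P e (Function.minimalPeriod σ e) = 1 := hper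
  have hmod : ∀ i, P e i = P e (i % Function.minimalPeriod σ e) := by
    have hmul : ∀ q, P e (Function.minimalPeriod σ e * q) = 1 := by
      intro q
      induction q with
      | zero => simp [P]
      | succ q ih =>
        rw [Nat.mul_succ, hadd, ih, one_mul,
          ← Function.iterate_mod_minimalPeriod_eq (n := Function.minimalPeriod σ e * q)]
        simpa using hP
    intro i
    conv_lhs => rw [← Nat.div_add_mod i (Function.minimalPeriod σ e)]
    rw [hadd, hmul, one_mul,
      ← Function.iterate_mod_minimalPeriod_eq (n := Function.minimalPeriod σ e * _)]
    simp
  have hpos : 0 < Function.minimalPeriod σ e :=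
    Function.minimalPeriod_pos_of_mem_periodicPts
      (Function.Injective.mem_periodicPts σ.injective e)
  have h1 : P e (n (σ d)) = P e (n d + 1) := by
    rw [hmod, hmod (n d + 1)]
    congr 1
    apply (Function.iterate_eq_iterate_iff_of_lt_minimalPeriod (Nat.mod_lt _ hpos)
      (Nat.mod_lt _ hpos)).1
    rw [Function.iterate_mod_minimalPeriod_eq, Function.iterate_mod_minimalPeriod_eq, hsd,
      Function.iterate_succ_apply', hd1]
  rw [h1, hadd, hd1]
  simp [P]

end CycleSums

section Eval

variable {m : ℕ} (R : Finset (Word m))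

@[simp] lemma eval_nil : eval R [] = 1 := rfl

lemma eval_append (u v : Word m) : eval R (u ++ v) = eval R u * eval R v := by
  rw [eval, ← FreeGroup.mul_mk, map_mul]; rfl

lemma eval_cons (a : Fin m × Bool) (v : Word m) : eval R (a :: v) = eval R [a] * eval R v :=
  eval_append R [a] v

lemma eval_invRev (u : Word m) : eval R (FreeGroup.invRev u) = (eval R u)⁻¹ := by
  rw [eval, ← FreeGroup.inv_mk, map_inv]; rfl

lemma eval_eq_prod (u : Word m) : eval R u = (u.map fun a => eval R [a]).prod := by
  induction u with
  | nil => simp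
  | cons a u ih => rw [eval_cons, ih]; simp

lemma eval_invLetter (a : Fin m × Bool) : eval R [invLetter a] = (eval R [a])⁻¹ := by
  rw [← eval_invRev]; rfl

lemma eval_eq_one_of_isRotated {u v : Word m} (h : u ~r v) (hv : eval R v = 1) :
    eval R u = 1 := by
  obtain ⟨n, rfl⟩ := h
  rw [List.rotate_eq_drop_append_take_mod, eval_append] at hv
  rw [← List.take_append_drop (n % u.length) u, eval_append]
  exact mul_eq_one_comm.1 hv

lemma eval_relator {r : Word m} (hr : r ∈ R) : eval R r = 1 :=
  (QuotientGroup.eq_one_iff _).2 (Subgroup.subset_normalClosure ⟨r, hr, rfl⟩)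

/-- A function that changes by at most one along each edge of the Cayley graph. -/
def IsLip (X : PresGroup R → ℤ) : Prop :=
  ∀ g a, |X (g * eval R [a]) - X g| ≤ 1

end Eval

namespace VanKampenDiagram

variable {m : ℕ} {R : Finset (Word m)} (D : VanKampenDiagram R)

lemma isMap : IsMap D.flip D.next := ⟨D.flip_flip, D.flip_ne, D.connected⟩

lemma label_flip' (d : D.Dart) : D.label (D.flip d) = invLetter (D.label d) := D.label_flip d

variable {D} {o : D.Dart}

lemma boundaryWord_of_root (ho : D.root = some o) :
    D.boundaryWord = readCycle D.next D.label o := by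
  rw [boundaryWord, ho]

lemma length_boundaryWord (ho : D.root = some o) :
    D.boundaryWord.length = Function.minimalPeriod D.next o := by
  rw [boundaryWord_of_root ho, readCycle]; simp

lemma exists_relator (ho : D.root = some o) {d : D.Dart} (hd : ¬ D.next.SameCycle o d) :
    ∃ r ∈ R, readCycle D.next D.label d ~r r ∨
      readCycle D.next D.label d ~r FreeGroup.invRev r := by
  apply D.face_relator
  intro o' ho'
  rw [ho] at ho'
  obtain rfl : o = o' := by simpa using ho'
  exact hd

lemma minimalPeriod_le {lam : ℕ} (hlam : ∀ r ∈ R, r.length ≤ lam) (ho : D.root = some o)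
    {d : D.Dart} (hd : ¬ D.next.SameCycle o d) : Function.minimalPeriod D.next d ≤ lam := by
  obtain ⟨r, hr, h⟩ := exists_relator ho hd
  have h1 : (readCycle D.next D.label d).length = Function.minimalPeriod D.next d := by
    simp [readCycle]
  rw [← h1]
  rcases h with h | h
  · rw [h.perm.length_eq]; exact hlam r hr
  · rw [h.perm.length_eq, FreeGroup.invRev_length]; exact hlam r hr

/-- A diagram maps to the Cayley graph. -/
lemma exists_map_cayley (ho : D.root = some o) :
    ∃ H : D.Dart → PresGroup R, H o = 1 ∧ ∀ d, H (D.next d) = H d * eval R [D.label d] ∧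
      H (D.flip d) = H d * eval R [D.label d] := by
  obtain ⟨k, hk⟩ := exists_primitive D.next (fun d => eval R [D.label d])
  obtain ⟨H, hH⟩ := D.isMap.exists_potential (l := fun d => eval R [D.label d])
    (fun d => by rw [label_flip', eval_invLetter]) o (D.euler ⟨o⟩) k (by
      intro d hd
      apply hk
      intro e he
      obtain ⟨r, hr, h⟩ := exists_relator (d := e) ho (fun hc => hd (hc.trans he))
      have h1 : eval R (readCycle D.next D.label e) = 1 := by
        rcases h with h | h
        · exact eval_eq_one_of_isRotated R h (eval_relator R hr)
        · exact eval_eq_one_of_isRotated R h (by rw [eval_invRev, eval_relator R hr, inv_one])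
      rw [eval_eq_prod, readCycle, List.map_map] at h1
      exact h1)
  refine ⟨fun d => (H o)⁻¹ * H d, by simp, fun d => ?_⟩
  simp only [(hH d).1, (hH d).2, mul_assoc, and_self]

lemma map_cayley_iterate (ho : D.root = some o) {H : D.Dart → PresGroup R} (h1 : H o = 1)
    (hH : ∀ d, H (D.next d) = H d * eval R [D.label d]) {i : ℕ}
    (hi : i ≤ D.boundaryWord.length) :
    H (D.next^[i] o) = eval R (D.boundaryWord.take i) := by
  induction i with
  | zero => simpa using h1
  | succ i ih =>
    rw [Function.iterate_succ_apply', hH, ih (by omega), List.take_succ_eq_append_getElem (by omega),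
      eval_append]
    congr 3
    simp only [boundaryWord_of_root ho, readCycle]
    simp

open Classical in
lemma area_eq (ho : D.root = some o) :
    D.area = (Finset.univ.filter fun d => cls D.next d ≠ cls D.next o).card := by
  have hface : ∀ f : D.SphereFace, (∀ o ∈ D.root, Quotient.mk _ o ≠ f) ↔ f ≠ cls D.next o := by
    intro f
    rw [ho]
    simp [cls, eq_comm]
  have h1 : ∀ f : D.Face, D.faceLength f = (Finset.univ.filter fun d => cls D.next d = f.1).card := by
    intro f
    rw [faceLength, Nat.card_eq_fintype_card, Fintype.card_subtype]
  rw [area, Finset.sum_congr rfl fun f _ => h1 f]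
  have h2 : ∀ d ∈ (Finset.univ.filter fun d => cls D.next d ≠ cls D.next o),
      cls D.next d ∈ (Finset.univ : Finset D.Face).image Subtype.val := by
    intro d hd
    rw [Finset.mem_filter] at hd
    exact Finset.mem_image.2 ⟨⟨cls D.next d, (hface _).2 hd.2⟩, Finset.mem_univ _, rfl⟩
  rw [Finset.card_eq_sum_card_fiberwise h2,
    Finset.sum_image (fun _ _ _ _ h => Subtype.val_injective h)]
  refine Finset.sum_congr rfl fun f _ => ?_
  congr 1
  ext d
  simp only [Finset.mem_filter, Finset.mem_univ, true_and]
  constructor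
  · intro hd
    exact ⟨by rw [hd]; exact (hface _).1 f.2, hd⟩
  · exact fun hd => hd.2

/-- The signed area enclosed by the image of the boundary in the plane under a pair of Lipschitz
functions is controlled by the area of the diagram. -/
theorem signed_area_le {lam : ℕ} (hlam : ∀ r ∈ R, r.length ≤ lam) (D : VanKampenDiagram R)
    {X Y : PresGroup R → ℤ} (hX : IsLip R X) (hY : IsLip R Y) :
    |∑ i ∈ Finset.range D.boundaryWord.length,
      (X (eval R (D.boundaryWord.take i)) + X (eval R (D.boundaryWord.take (i + 1)))) *
      (Y (eval R (D.boundaryWord.take (i + 1))) - Y (eval R (D.boundaryWord.take i)))|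
      ≤ 2 * lam * D.area := by
  classical
  rcases hroot : D.root with _ | o
  · simp only [boundaryWord, hroot]
    simp only [List.length_nil, Finset.range_zero, Finset.sum_empty, abs_zero]
    positivity
  obtain ⟨H, h1, hH⟩ := exists_map_cayley hroot
  let x : D.Dart → ℤ := fun d => X (H d)
  let y : D.Dart → ℤ := fun d => Y (H d)
  have hx : ∀ d, |x (D.next d) - x d| ≤ 1 := fun d => by simp only [x, (hH d).1]; exact hX _ _
  have hy : ∀ d, |y (D.next d) - y d| ≤ 1 := fun d => by simp only [y, (hH d).1]; exact hY _ _
  let F : D.Dart → ℤ := fun d => (x d + x (D.next d)) * (y (D.next d) - y d)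
  have hFflip : ∀ d, F (D.flip d) = - F d := by
    intro d
    have e1 : H (D.next (D.flip d)) = H d := by
      rw [(hH _).1, ← (hH _).2, D.flip_flip]
    have e2 : H (D.next d) = H (D.flip d) := by rw [(hH d).1, (hH d).2]
    simp only [F, x, y, e1, e2]
    ring
  have hsum : ∑ d, F d = 0 := by
    have h2 : ∑ d, F (D.flip d) = ∑ d, F d := Equiv.sum_comp D.flip F
    simp only [hFflip, Finset.sum_neg_distrib] at h2
    linarith
  have houter : ∑ d with cls D.next d = cls D.next o, F d =
      ∑ i ∈ Finset.range D.boundaryWord.length,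
      (X (eval R (D.boundaryWord.take i)) + X (eval R (D.boundaryWord.take (i + 1)))) *
      (Y (eval R (D.boundaryWord.take (i + 1))) - Y (eval R (D.boundaryWord.take i))) := by
    rw [sum_cycle, length_boundaryWord hroot]
    refine Finset.sum_congr rfl fun i hi => ?_
    rw [Finset.mem_range, ← length_boundaryWord hroot] at hi
    have e1 := map_cayley_iterate hroot h1 (fun d => (hH d).1) hi.le
    have e2 := map_cayley_iterate hroot h1 (fun d => (hH d).1) (Nat.succ_le_of_lt hi)
    simp only [F, x, y]
    rw [← Function.iterate_succ_apply' D.next i o, e1, e2]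
  rw [← houter]
  have hsplit := Finset.sum_filter_add_sum_filter_not Finset.univ
    (fun d => cls D.next d = cls D.next o) F
  rw [hsum] at hsplit
  rw [eq_neg_of_add_eq_zero_left hsplit, abs_neg, area_eq hroot]
  let x₀ : D.Dart → ℤ := fun d => x (cls D.next d).out
  have hx₀ : ∑ d with ¬ cls D.next d = cls D.next o, x₀ d * (y (D.next d) - y d) = 0 := by
    simp only [mul_sub, Finset.sum_sub_distrib]
    rw [sub_eq_zero, Finset.sum_filter, Finset.sum_filter]
    conv_rhs => rw [← Equiv.sum_comp D.next]
    refine Finset.sum_congr rfl fun d _ => ?_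
    simp only [x₀, cls_apply]
  have hdist : ∀ d, ¬ cls D.next d = cls D.next o → |x d - x₀ d| ≤ lam := by
    intro d hd
    have hs := cls_eq_iff.1 (Quotient.out_eq (cls D.next d))
    obtain ⟨i, hi, hid⟩ := SameCycle.exists_iterate hs
    have hi' : i ≤ lam := by
      refine hi.le.trans (minimalPeriod_le hlam hroot fun hc => hd ?_)
      exact (cls_eq_iff.2 (hc.trans hs)).symm
    have key : ∀ j : ℕ, |x (D.next^[j] (cls D.next d).out) - x₀ d| ≤ j := by
      intro j
      induction j with
      | zero => simp [x₀]
      | succ j ih =>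
        rw [Function.iterate_succ_apply']
        have := hx (D.next^[j] (cls D.next d).out)
        rw [abs_le] at *
        push_cast
        constructor <;> linarith [this.1, this.2, ih.1, ih.2]
    have := key i
    rw [hid] at this
    exact this.trans (by exact_mod_cast hi')
  have hrew : ∑ d with ¬ cls D.next d = cls D.next o, F d =
      ∑ d with ¬ cls D.next d = cls D.next o,
        (x d - x₀ d + (x (D.next d) - x₀ d)) * (y (D.next d) - y d) := by
    have : ∀ d, F d = (x d - x₀ d + (x (D.next d) - x₀ d)) * (y (D.next d) - y d)
        + 2 * (x₀ d * (y (D.next d) - y d)) := fun d => by simp only [F]; ring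
    simp only [this]
    rw [Finset.sum_add_distrib, ← Finset.mul_sum, hx₀]
    simp
  rw [hrew]
  refine (Finset.abs_sum_le_sum_abs _ _).trans ?_
  have hbound : ∀ d ∈ Finset.univ.filter (fun d => ¬ cls D.next d = cls D.next o),
      |(x d - x₀ d + (x (D.next d) - x₀ d)) * (y (D.next d) - y d)| ≤ 2 * lam := by
    intro d hd
    have hd' := (Finset.mem_filter.1 hd).2
    have e1 := hdist d hd'
    have e2 := hdist (D.next d) (by rwa [cls_apply])
    have e3 : x₀ (D.next d) = x₀ d := by simp only [x₀, cls_apply]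
    rw [e3] at e2
    rw [abs_mul]
    have e4 : |x d - x₀ d + (x (D.next d) - x₀ d)| ≤ 2 * lam :=
      (abs_add_le _ _).trans (by linarith)
    calc _ ≤ (2 * lam : ℤ) * 1 := mul_le_mul e4 (hy d) (abs_nonneg _) (by positivity)
      _ = _ := mul_one _
  refine (Finset.sum_le_card_nsmul _ _ _ hbound).trans ?_
  rw [nsmul_eq_mul]
  exact le_of_eq (by ring)

/-- In a diagram whose boundary word is a shortest nontrivial relation, every boundary edge lies on
a face. -/
lemma length_le_area (D : VanKampenDiagram R) (hne : D.boundaryWord ≠ [])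
    (hred : FreeGroup.IsReduced D.boundaryWord)
    (hmin : ∀ v : Word m, FreeGroup.IsReduced v → eval R v = 1 → v ≠ [] →
      D.boundaryWord.length ≤ v.length) :
    D.boundaryWord.length ≤ D.area := by
  classical
  rcases hroot : D.root with _ | o
  · exact absurd (by simp only [boundaryWord, hroot]) hne
  obtain ⟨H, h1, hH⟩ := exists_map_cayley hroot
  have key : ∀ i j, i < j → j < D.boundaryWord.length → D.flip (D.next^[i] o) ≠ D.next^[j] o := by
    intro i j hij hj hflip
    have e1 := map_cayley_iterate hroot h1 (fun d => (hH d).1) (show i + 1 ≤ _ by omega)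
    have e2 := map_cayley_iterate hroot h1 (fun d => (hH d).1) hj.le
    rw [← hflip, (hH _).2, ← (hH _).1, ← Function.iterate_succ_apply' D.next, e1] at e2
    by_cases hj' : j = i + 1
    · subst hj'
      have hl : ∀ n, (hn : n < D.boundaryWord.length) →
          D.boundaryWord[n] = D.label (D.next^[n] o) := by
        intro n hn
        simp only [boundaryWord_of_root hroot, readCycle]
        simp
      have hc := List.isChain_iff_getElem.1 hred i hj
      rw [hl i (by omega), hl (i + 1) hj, ← hflip, D.label_flip] at hc
      simp at hc
    · have hsplit : D.boundaryWord.take j =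
          D.boundaryWord.take (i + 1) ++ (D.boundaryWord.take j).drop (i + 1) := by
        conv_lhs => rw [← List.take_append_drop (i + 1) (D.boundaryWord.take j)]
        rw [List.take_take, min_eq_left (by omega)]
      rw [hsplit, eval_append] at e2
      have hlen : ((D.boundaryWord.take j).drop (i + 1)).length = j - (i + 1) := by
        rw [List.length_drop, List.length_take, min_eq_left hj.le]
      have := hmin ((D.boundaryWord.take j).drop (i + 1))
        (hred.infix ((List.drop_suffix _ _).isInfix.trans (List.take_prefix _ _).isInfix))
        (by simpa using e2.symm) (by rw [← List.length_pos_iff_ne_nil, hlen]; omega)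
      omega
  rw [area_eq hroot]
  have hcard : (Finset.univ.filter fun d => cls D.next d = cls D.next o).card =
      D.boundaryWord.length := by
    rw [Finset.card_eq_sum_ones, sum_cycle, length_boundaryWord hroot]; simp
  rw [← hcard]
  apply Finset.card_le_card_of_injOn D.flip _ D.flip.injective.injOn
  intro d hd
  simp only [Finset.coe_filter, Finset.mem_univ, true_and] at hd ⊢
  intro hc
  obtain ⟨i, hi, hid⟩ := SameCycle.exists_iterate (cls_eq_iff.1 hd).symm
  obtain ⟨j, hj, hjd⟩ := SameCycle.exists_iterate (cls_eq_iff.1 hc).symm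
  rw [← length_boundaryWord hroot] at hi hj
  rcases lt_trichotomy i j with hij | rfl | hij
  · exact key i j hij hj (by rw [hid, hjd])
  · exact D.flip_ne d (by rw [← hjd, hid])
  · exact key j i hij hi (by rw [hid, hjd, D.flip_flip])

lemma lam_pos {lam : ℕ} (hlam : ∀ r ∈ R, r.length ≤ lam) (D : VanKampenDiagram R)
    (hD : D.boundaryWord ≠ []) (harea : 0 < D.area) : 0 < lam := by
  classical
  rcases hroot : D.root with _ | o
  · exact absurd (by simp only [boundaryWord, hroot]) hD
  rw [area_eq hroot, Finset.card_pos] at harea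
  obtain ⟨d, hd⟩ := harea
  have h1 := minimalPeriod_le hlam hroot (d := d)
    fun hc => (Finset.mem_filter.1 hd).2 (cls_eq_iff.2 hc).symm
  have h2 : 0 < Function.minimalPeriod D.next d :=
    Function.minimalPeriod_pos_of_mem_periodicPts
      (Function.Injective.mem_periodicPts D.next.injective d)
  omega

end VanKampenDiagram

end Cogrowth

namespace Cogrowth

section Cut

variable {m : ℕ} (R : Finset (Word m))

/-- The distance in the Cayley graph to the set `S`, truncated at `c`. -/
noncomputable def truncDist (S : Set (PresGroup R)) (c : ℕ) (g : PresGroup R) : ℕ :=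
  sInf {n | n = c ∨ ∃ s ∈ S, ∃ p : Word m, p.length = n ∧ g = s * eval R p}

variable {R} {S : Set (PresGroup R)} {c : ℕ} {g : PresGroup R}

lemma truncDist_le : truncDist R S c g ≤ c := Nat.sInf_le (Or.inl rfl)

lemma truncDist_eq_zero (hg : g ∈ S) : truncDist R S c g = 0 :=
  Nat.le_zero.1 (Nat.sInf_le (Or.inr ⟨g, hg, [], rfl, by simp⟩))

lemma truncDist_spec : truncDist R S c g = c ∨
    ∃ s ∈ S, ∃ p : Word m, p.length = truncDist R S c g ∧ g = s * eval R p :=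
  Nat.sInf_mem (s := {n | n = c ∨ ∃ s ∈ S, ∃ p : Word m, p.length = n ∧ g = s * eval R p})
    ⟨c, Or.inl rfl⟩

lemma truncDist_mul_le (a : Fin m × Bool) :
    truncDist R S c (g * eval R [a]) ≤ truncDist R S c g + 1 := by
  rcases truncDist_spec (R := R) (S := S) (c := c) (g := g) with h | ⟨s, hs, p, hp, hg⟩
  · rw [h]; exact truncDist_le.trans (Nat.le_succ _)
  · refine Nat.sInf_le (Or.inr ⟨s, hs, p ++ [a], by simp [hp], ?_⟩)
    rw [eval_append, ← mul_assoc, ← hg]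

lemma isLip_truncDist (S : Set (PresGroup R)) (c : ℕ) :
    IsLip R fun g => (truncDist R S c g : ℤ) := by
  intro g a
  have h1 := truncDist_mul_le (R := R) (S := S) (c := c) (g := g) a
  have h2 := truncDist_mul_le (R := R) (S := S) (c := c) (g := g * eval R [a]) (invLetter a)
  rw [eval_invLetter, mul_inv_cancel_right] at h2
  rw [abs_le]
  constructor <;> push_cast <;> linarith [(Nat.cast_le (α := ℤ)).2 h1, (Nat.cast_le (α := ℤ)).2 h2,
    (Nat.cast_succ (R := ℤ) (truncDist R S c g)), (Nat.cast_succ (R := ℤ) (truncDist R S c (g * eval R [a])))]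

/-- The signed area of a loop that runs once around a square. -/
lemma sum_square {x y : ℕ → ℤ} {q n : ℕ} {c : ℤ} (hq : 0 < q) (hn : 3 * q < n)
    (h1 : ∀ i, i ≤ q → x i = 0) (h2 : ∀ i, q ≤ i → i ≤ 2 * q → y i = 0)
    (h3 : ∀ i, 2 * q ≤ i → i ≤ 3 * q → x i = c) (h4 : ∀ i, 3 * q ≤ i → i ≤ n → y i = c) :
    ∑ i ∈ Finset.range n, (x i + x (i + 1)) * (y (i + 1) - y i) = 2 * c ^ 2 := by
  let z : ℕ → ℤ := fun i => if i ≤ 2 * q then 0 else if i ≤ 3 * q then y i else c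
  have key : ∀ i ∈ Finset.range n,
      (x i + x (i + 1)) * (y (i + 1) - y i) = 2 * c * (z (i + 1) - z i) := by
    intro i hi
    have hi := Finset.mem_range.1 hi
    rcases lt_or_ge i q with hiq | hiq
    · rw [h1 i hiq.le, h1 (i + 1) hiq]
      simp only [z, if_pos (show i ≤ 2 * q by omega), if_pos (show i + 1 ≤ 2 * q by omega)]
      ring
    rcases lt_or_ge i (2 * q) with hiq2 | hiq2
    · rw [h2 i hiq hiq2.le, h2 (i + 1) (by omega) hiq2]
      simp only [z, if_pos (show i ≤ 2 * q by omega), if_pos (show i + 1 ≤ 2 * q by omega)]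
      ring
    rcases lt_or_ge i (3 * q) with hiq3 | hiq3
    · rw [h3 i hiq2 hiq3.le, h3 (i + 1) (by omega) hiq3]
      have e1 : z i = y i := by
        simp only [z]
        split_ifs with h5 h6
        · exact (h2 i hiq h5).symm
        · rfl
        · omega
      have e2 : z (i + 1) = y (i + 1) := by
        simp only [z, if_neg (show ¬ i + 1 ≤ 2 * q by omega), if_pos (show i + 1 ≤ 3 * q by omega)]
      rw [e1, e2]; ring
    · rw [h4 i hiq3 hi.le, h4 (i + 1) (by omega) hi]
      have e1 : z i = c := by
        simp only [z, if_neg (show ¬ i ≤ 2 * q by omega)]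
        split_ifs with h6
        · exact h4 i hiq3 hi.le
        · rfl
      have e2 : z (i + 1) = c := by
        simp only [z, if_neg (show ¬ i + 1 ≤ 2 * q by omega), if_neg (show ¬ i + 1 ≤ 3 * q by omega)]
      rw [e1, e2]; ring
  rw [Finset.sum_congr rfl key, ← Finset.mul_sum, Finset.sum_range_sub]
  simp only [z, if_neg (show ¬ n ≤ 2 * q by omega), if_neg (show ¬ n ≤ 3 * q by omega),
    if_pos (Nat.zero_le _)]
  ring

lemma exists_reduced (p : Word m) :
    ∃ p' : Word m, FreeGroup.IsReduced p' ∧ p'.length ≤ p.length ∧ eval R p' = eval R p := by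
  refine ⟨(FreeGroup.mk p).toWord, FreeGroup.isReduced_toWord, FreeGroup.norm_mk_le, ?_⟩
  rw [eval, FreeGroup.mk_toWord, eval]

lemma eval_take_add (w : Word m) (i n : ℕ) :
    eval R (w.take (i + n)) = eval R (w.take i) * eval R ((w.drop i).take n) := by
  rw [List.take_add, eval_append]

/-- The boundary word of a diagram of small area has a long subword with long complement that is
equal in the group to a short word. -/
theorem exists_cut {lam k : ℕ} (hlam : ∀ r ∈ R, r.length ≤ lam) (D : VanKampenDiagram R)
    (hk : lam * D.area < (k + 1) ^ 2) (hlen : 4 ≤ D.boundaryWord.length) :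
    ∃ (i n : ℕ) (p : Word m), i + n ≤ D.boundaryWord.length ∧ D.boundaryWord.length / 4 ≤ n ∧
      n + D.boundaryWord.length / 4 ≤ D.boundaryWord.length ∧ FreeGroup.IsReduced p ∧
      p.length ≤ k ∧ eval R ((D.boundaryWord.drop i).take n) = eval R p := by
  by_contra hcon
  set w := D.boundaryWord with hw
  set q := w.length / 4 with hq
  have hq4 : 4 * q ≤ w.length := Nat.mul_div_le _ _
  have hq0 : 0 < q := Nat.div_pos hlen (by norm_num)
  let v : ℕ → PresGroup R := fun i => eval R (w.take i)
  have hfar : ∀ a b j, j ≤ w.length → (∀ i, a ≤ i → i ≤ b → i + q ≤ j ∧ j + q ≤ w.length + i) →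
      truncDist R (v '' Set.Icc a b) (k + 1) (v j) = k + 1 := by
    intro a b j hj hij
    rcases truncDist_spec (R := R) (S := v '' Set.Icc a b) (c := k + 1) (g := v j) with
      h | ⟨s, ⟨i, hi, rfl⟩, p, hp, hg⟩
    · exact h
    by_contra hne
    have hlt := lt_of_le_of_ne truncDist_le hne
    obtain ⟨h1, h2⟩ := hij i hi.1 hi.2
    obtain ⟨p', hp', hpl, hpe⟩ := exists_reduced (R := R) p
    refine hcon ⟨i, j - i, p', by omega, by omega, by omega, hp', by omega, ?_⟩
    have h3 := eval_take_add (R := R) w i (j - i)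
    rw [show i + (j - i) = j by omega] at h3
    rw [hpe]
    exact mul_left_cancel (h3.symm.trans hg)
  have hsum := D.signed_area_le hlam (isLip_truncDist (v '' Set.Icc 0 q) (k + 1))
    (isLip_truncDist (v '' Set.Icc q (2 * q)) (k + 1))
  rw [← hw, sum_square (x := fun i => truncDist R (v '' Set.Icc 0 q) (k + 1) (v i))
    (y := fun i => truncDist R (v '' Set.Icc q (2 * q)) (k + 1) (v i)) (q := q) (c := k + 1) hq0
    (by omega)] at hsum
  · rw [abs_of_nonneg (by positivity)] at hsum
    have : ((lam * D.area : ℕ) : ℤ) < ((k + 1) ^ 2 : ℕ) := by exact_mod_cast hk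
    push_cast at this
    linarith
  · intro i hi
    simp only [truncDist_eq_zero (Set.mem_image_of_mem v (show i ∈ Set.Icc 0 q from ⟨by omega, hi⟩))]
    rfl
  · intro i hi hi'
    simp only [truncDist_eq_zero (Set.mem_image_of_mem v (show i ∈ Set.Icc q (2 * q) from ⟨hi, hi'⟩))]
    rfl
  · intro i hi hi'
    rw [hfar 0 q i (by omega) (by intros; omega)]
    push_cast; rfl
  · intro i hi hi'
    rw [hfar q (2 * q) i hi' (by intros; omega)]
    push_cast; rfl

end Cut

end Cogrowth

namespace Cogrowth

section Counting

variable {m : ℕ}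

lemma isReduced_cons_cons {a b : Fin m × Bool} {l : Word m} :
    FreeGroup.IsReduced (a :: b :: l) ↔ b ≠ invLetter a ∧ FreeGroup.IsReduced (b :: l) := by
  unfold FreeGroup.IsReduced
  rw [List.isChain_cons_cons]
  refine and_congr_left fun _ => ?_
  rcases a with ⟨a, _ | _⟩ <;> rcases b with ⟨b, _ | _⟩ <;> simp [invLetter, eq_comm]

lemma isReduced_append_cons {a b : Fin m × Bool} {u v : Word m} :
    FreeGroup.IsReduced (u ++ [a] ++ b :: v) ↔
      b ≠ invLetter a ∧ FreeGroup.IsReduced (u ++ [a]) ∧ FreeGroup.IsReduced (b :: v) := by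
  have h : (a.1 = b.1 → a.2 = b.2) ↔ b ≠ invLetter a := by
    rcases a with ⟨a, _ | _⟩ <;> rcases b with ⟨b, _ | _⟩ <;> simp [invLetter, eq_comm]
  unfold FreeGroup.IsReduced
  rw [List.isChain_append, ← h]
  simp
  tauto

/-- The cancellations in a product of two reduced words. -/
lemma exists_cancellation (v u : Word m) (hv : FreeGroup.IsReduced v)
    (hu : FreeGroup.IsReduced u) :
    ∃ v' z u' : Word m, v = v' ++ z ∧ u = FreeGroup.invRev z ++ u' ∧
      FreeGroup.IsReduced (v' ++ u') := by
  induction v using List.reverseRecOn generalizing u with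
  | nil => exact ⟨[], [], u, rfl, rfl, hu⟩
  | append_singleton v a ih =>
    cases u with
    | nil => exact ⟨v ++ [a], [], [], by simp, rfl, by simpa using hv⟩
    | cons b u =>
      by_cases hb : b = invLetter a
      · obtain ⟨v', z, u', rfl, rfl, h⟩ := ih u (hv.infix (List.prefix_append _ _).isInfix)
          (hu.infix (List.suffix_cons _ _).isInfix)
        exact ⟨v', z ++ [a], u', by simp, by simp [FreeGroup.invRev, hb, invLetter], h⟩
      · exact ⟨v ++ [a], [], b :: u, by simp, rfl, isReduced_append_cons.2 ⟨hb, hv, hu⟩⟩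

open Classical in
/-- The reduced words of length `n`. -/
noncomputable def redWords (m n : ℕ) : Finset (Word m) :=
  (List.finite_length_eq (Fin m × Bool) n).toFinset.filter FreeGroup.IsReduced

lemma mem_redWords {n : ℕ} {w : Word m} :
    w ∈ redWords m n ↔ w.length = n ∧ FreeGroup.IsReduced w := by
  simp [redWords]

open Classical in
/-- The reduced words of length `n` that represent `g`. -/
noncomputable def wordsOf (R : Finset (Word m)) (g : PresGroup R) (n : ℕ) : Finset (Word m) :=
  (redWords m n).filter fun w => eval R w = g

lemma mem_wordsOf {R : Finset (Word m)} {g : PresGroup R} {n : ℕ} {w : Word m} :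
    w ∈ wordsOf R g n ↔ w.length = n ∧ FreeGroup.IsReduced w ∧ eval R w = g := by
  simp [wordsOf, mem_redWords, and_assoc]

lemma ncard_W (R : Finset (Word m)) (n : ℕ) : (W R n).ncard = (wordsOf R 1 n).card := by
  rw [← Set.ncard_coe_finset]
  congr 1
  ext w
  simp only [Finset.mem_coe, mem_wordsOf]
  change (FreeGroup.IsReduced w ∧ w.length = n ∧ eval R w = 1) ↔ _
  tauto

lemma card_letters_ne (a : Fin m × Bool) :
    (Finset.univ.filter fun x : Fin m × Bool => x ≠ a).card = 2 * m - 1 := by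
  rw [Finset.filter_ne' Finset.univ a, Finset.card_erase_of_mem (Finset.mem_univ _)]
  simp [mul_comm]

lemma card_redWords_succ_le (n : ℕ) :
    (redWords m (n + 2)).card ≤ (2 * m - 1) * (redWords m (n + 1)).card := by
  classical
  have himg : (redWords m (n + 2)).image List.tail ⊆ redWords m (n + 1) := by
    intro w hw
    obtain ⟨v, hv, rfl⟩ := Finset.mem_image.1 hw
    rw [mem_redWords] at hv ⊢
    exact ⟨by simp [hv.1], hv.2.infix (List.tail_suffix v).isInfix⟩
  refine (Finset.card_le_mul_card_image (f := List.tail) _ (2 * m - 1) ?_).trans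
    (Nat.mul_le_mul_left _ (Finset.card_le_card himg))
  intro w hw
  have hw' := mem_redWords.1 (himg hw)
  obtain ⟨c, w, rfl⟩ := List.exists_cons_of_length_eq_add_one hw'.1
  rw [← card_letters_ne (invLetter c)]
  refine (Finset.card_le_card (t := (Finset.univ.filter fun x : Fin m × Bool =>
    x ≠ invLetter c).image fun x => x :: c :: w) ?_).trans Finset.card_image_le
  intro v hv
  obtain ⟨hv, hvw⟩ := Finset.mem_filter.1 hv
  obtain ⟨hvl, hvr⟩ := mem_redWords.1 hv
  obtain ⟨x, v, rfl⟩ := List.exists_cons_of_length_eq_add_one hvl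
  obtain rfl : v = c :: w := hvw
  refine Finset.mem_image.2 ⟨x, Finset.mem_filter.2 ⟨Finset.mem_univ _, ?_⟩, rfl⟩
  rintro rfl
  exact (isReduced_cons_cons.1 hvr).1 (by simp)

lemma card_redWords_le (hm : 2 ≤ m) (n : ℕ) : (redWords m n).card ≤ (2 * m - 1) ^ (n + 1) := by
  induction n with
  | zero =>
    refine (Finset.card_le_one.2 ?_).trans (Nat.one_le_pow _ _ (by omega))
    intro u hu v hv
    rw [List.length_eq_zero_iff.1 (mem_redWords.1 hu).1,
      List.length_eq_zero_iff.1 (mem_redWords.1 hv).1]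
  | succ n ih =>
    cases n with
    | zero =>
      have h1 : (redWords m 1).card ≤ (Finset.univ.image fun x : Fin m × Bool => [x]).card := by
        apply Finset.card_le_card
        intro w hw
        obtain ⟨x, rfl⟩ := List.length_eq_one_iff.1 (mem_redWords.1 hw).1
        simp
      have h2 := h1.trans Finset.card_image_le
      rw [Finset.card_univ, Fintype.card_prod, Fintype.card_fin, Fintype.card_bool] at h2
      obtain ⟨k, rfl⟩ : ∃ k, m = k + 2 := ⟨m - 2, by omega⟩
      refine h2.trans ?_
      rw [show 2 * (k + 2) - 1 = 2 * k + 3 by omega]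
      ring_nf
      nlinarith
    | succ n =>
      refine (card_redWords_succ_le n).trans ?_
      rw [pow_succ' _ (n + 1 + 1)]
      exact Nat.mul_le_mul_left _ ih

variable {R : Finset (Word m)}

lemma eval_one_of_conj {a : Fin m × Bool} {y : Word m} :
    eval R (a :: (y ++ [invLetter a])) = 1 ↔ eval R y = 1 := by
  rw [eval_cons, eval_append, eval_invLetter, ← mul_assoc]
  exact conj_eq_one_iff

open Classical in
/-- Relations of the form `a y a⁻¹`. -/
noncomputable def conjWords (R : Finset (Word m)) (n : ℕ) : Finset (Word m) :=
  (wordsOf R 1 n).filter fun w => ∃ a y, w = a :: (y ++ [invLetter a])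

lemma mul_card_le_card_conjWords {n N : ℕ} {t : Finset (Word m)} (ht : t ⊆ wordsOf R 1 n)
    (hN : ∀ y ∈ t, ∃ s : Finset (Fin m × Bool), N ≤ s.card ∧
      ∀ x ∈ s, FreeGroup.IsReduced (x :: (y ++ [invLetter x]))) :
    N * t.card ≤ (conjWords R (n + 2)).card := by
  classical
  refine (Finset.mul_card_image_le_card_of_maps_to (f := fun w : Word m => w.tail.dropLast)
    (s := (conjWords R (n + 2)).filter fun w => w.tail.dropLast ∈ t) (t := t)
    (fun w hw => (Finset.mem_filter.1 hw).2) N ?_).trans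
    (Finset.card_le_card (Finset.filter_subset _ _))
  intro y hy
  obtain ⟨s, hs, hsy⟩ := hN y hy
  refine hs.trans ?_
  refine Finset.card_le_card_of_injOn (fun x => x :: (y ++ [invLetter x])) ?_ ?_
  · intro x hx
    obtain ⟨h1, -, h3⟩ := mem_wordsOf.1 (ht hy)
    have e : (x :: (y ++ [invLetter x])).tail.dropLast = y := by simp
    refine Finset.mem_coe.2 (Finset.mem_filter.2 ⟨Finset.mem_filter.2 ⟨Finset.mem_filter.2
      ⟨mem_wordsOf.2 ⟨by simp [h1], hsy x hx, eval_one_of_conj.2 h3⟩, x, y, rfl⟩, ?_⟩, e⟩)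
    rwa [e]
  · intro x _ x' _ h
    exact (List.cons.inj h).1

lemma isReduced_conj {x c d : Fin m × Bool} {y : Word m} {y' y'' : Word m} (hy : y = c :: y')
    (hy' : y = y'' ++ [d]) (hr : FreeGroup.IsReduced y) (hc : x ≠ invLetter c) (hd : x ≠ d) :
    FreeGroup.IsReduced (x :: (y ++ [invLetter x])) := by
  have h1 : FreeGroup.IsReduced (x :: y) := by
    rw [hy] at hr ⊢
    refine isReduced_cons_cons.2 ⟨?_, hr⟩
    rintro rfl
    simp at hc
  rw [hy', ← List.cons_append] at h1
  rw [hy', ← List.cons_append, ← List.cons_append]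
  refine isReduced_append_cons.2 ⟨?_, h1, FreeGroup.IsReduced.singleton⟩
  intro h
  apply hd
  have := congrArg invLetter h
  simpa using this

lemma mul_card_conjWords_le (n : ℕ) :
    (2 * m - 1) * (conjWords R n).card ≤ (conjWords R (n + 2)).card := by
  classical
  refine mul_card_le_card_conjWords (Finset.filter_subset _ _) ?_
  intro y hy
  obtain ⟨hy, a, z, hz⟩ := Finset.mem_filter.1 hy
  refine ⟨Finset.univ.filter fun x => x ≠ invLetter a, (card_letters_ne _).ge, ?_⟩
  intro x hx
  have hx := (Finset.mem_filter.1 hx).2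
  exact isReduced_conj (y' := z ++ [invLetter a]) (y'' := a :: z) hz (by simpa using hz)
    (mem_wordsOf.1 hy).2.1 hx hx

lemma mul_card_wordsOf_le {n : ℕ} (hn : 1 ≤ n) :
    (2 * m - 2) * (wordsOf R 1 n).card ≤ (conjWords R (n + 2)).card := by
  classical
  refine mul_card_le_card_conjWords subset_rfl ?_
  intro y hy
  obtain ⟨hl, hr, -⟩ := mem_wordsOf.1 hy
  obtain ⟨c, y', hy'⟩ := List.exists_cons_of_length_pos (l := y) (by omega)
  rcases List.eq_nil_or_concat' y with h | ⟨y'', d, hy''⟩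
  · simp [h] at hy'
  refine ⟨(Finset.univ.erase (invLetter c)).erase d, ?_, ?_⟩
  · have h1 := Finset.pred_card_le_card_erase (s := Finset.univ.erase (invLetter c)) (a := d)
    rw [Finset.card_erase_of_mem (Finset.mem_univ _)] at h1
    rw [Finset.card_univ, Fintype.card_prod, Fintype.card_fin, Fintype.card_bool] at h1
    omega
  · intro x hx
    simp only [Finset.mem_erase, Finset.mem_univ, and_true] at hx
    exact isReduced_conj hy' hy'' hr hx.2 hx.1

/-- Conjugation gives many long relations out of a short one. -/
lemma card_wordsOf_mul_pow_le (hm : 2 ≤ m) {n : ℕ} (hn : 1 ≤ n) (j : ℕ) :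
    (wordsOf R 1 n).card * (2 * m - 1) ^ j ≤ (2 * m - 1) * (wordsOf R 1 (n + 2 * j)).card := by
  classical
  have h1 : ∀ j, (2 * m - 1) ^ j * ((2 * m - 2) * (wordsOf R 1 n).card) ≤
      (conjWords R (n + 2 * (j + 1))).card := by
    intro j
    induction j with
    | zero => simpa using mul_card_wordsOf_le hn
    | succ j ih =>
      refine le_trans ?_ (mul_card_conjWords_le _)
      rw [pow_succ', mul_assoc]
      exact Nat.mul_le_mul_left _ ih
  cases j with
  | zero =>
    rw [pow_zero, mul_comm]
    exact Nat.mul_le_mul_right _ (by omega)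
  | succ j =>
    have h2 := (h1 j).trans (Finset.card_le_card (Finset.filter_subset _ _))
    calc (wordsOf R 1 n).card * (2 * m - 1) ^ (j + 1)
        = (2 * m - 1) * ((2 * m - 1) ^ j * (1 * (wordsOf R 1 n).card)) := by ring
      _ ≤ (2 * m - 1) * ((2 * m - 1) ^ j * ((2 * m - 2) * (wordsOf R 1 n).card)) := by
          gcongr; omega
      _ ≤ _ := Nat.mul_le_mul_left _ h2

/-- The number of words representing an element `p` of length at most `k` is controlled by the
number of relations. -/
lemma card_wordsOf_le {k n : ℕ} {p : Word m} (hp : p.length ≤ k) :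
    (wordsOf R (eval R p) n).card ≤
      ∑ n' ∈ Finset.range (n + k + 1), (wordsOf R 1 n').card := by
  classical
  refine le_trans ?_ Finset.card_biUnion_le
  refine Finset.card_le_card_of_injOn
    (fun s => (FreeGroup.mk s * (FreeGroup.mk p)⁻¹).toWord) ?_ ?_
  · intro s hs
    obtain ⟨h1, h2, h3⟩ := mem_wordsOf.1 hs
    simp only [Finset.coe_biUnion, Set.mem_iUnion, Finset.mem_coe]
    refine ⟨_, ?_, mem_wordsOf.2 ⟨rfl, FreeGroup.isReduced_toWord, ?_⟩⟩
    · rw [Finset.mem_range]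
      have h4 := FreeGroup.norm_mul_le (FreeGroup.mk s) (FreeGroup.mk p)⁻¹
      have h5 := FreeGroup.norm_mk_le (L₁ := s)
      have h6 := FreeGroup.norm_mk_le (L₁ := p)
      rw [FreeGroup.norm_inv_eq] at h4
      simp only [FreeGroup.norm] at h4 h5 h6
      omega
    · rw [eval, FreeGroup.mk_toWord, map_mul, map_inv]
      exact mul_inv_eq_one.2 h3
  · intro s hs s' hs' h
    have h1 := mul_right_cancel (FreeGroup.toWord_injective h)
    rw [← (mem_wordsOf.1 hs).2.1.reduce_eq, ← (mem_wordsOf.1 hs').2.1.reduce_eq,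
      ← FreeGroup.toWord_mk, ← FreeGroup.toWord_mk, h1]

open Classical in
/-- The pairs of reduced words `u`, `v` of lengths `i`, `j` such that `v u` represents `g`. -/
noncomputable def pairsOf (R : Finset (Word m)) (g : PresGroup R) (i j : ℕ) :
    Finset (Word m × Word m) :=
  (redWords m i ×ˢ redWords m j).filter fun p => eval R p.2 * eval R p.1 = g

lemma card_pairsOf_le (g : PresGroup R) (i j : ℕ) :
    (pairsOf R g i j).card ≤ ∑ t ∈ (Finset.range (i + j + 1)).filter (fun t => 2 * t ≤ i + j),
      (redWords m t).card * (wordsOf R g (i + j - 2 * t)).card := by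
  classical
  simp only [← Finset.card_product]
  refine le_trans (Finset.card_le_card (t := Finset.biUnion _ fun t =>
    ((redWords m t) ×ˢ (wordsOf R g (i + j - 2 * t))).image fun q : Word m × Word m =>
      (FreeGroup.invRev q.1 ++ q.2.drop (j - t), q.2.take (j - t) ++ q.1)) ?_)
    (Finset.card_biUnion_le.trans (Finset.sum_le_sum fun t _ => Finset.card_image_le))
  rintro ⟨u, v⟩ huv
  obtain ⟨huv, hg⟩ := Finset.mem_filter.1 huv
  obtain ⟨hu, hv⟩ := Finset.mem_product.1 huv
  obtain ⟨hul, hur⟩ := mem_redWords.1 hu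
  obtain ⟨hvl, hvr⟩ := mem_redWords.1 hv
  obtain ⟨v', z, u', rfl, rfl, hr⟩ := exists_cancellation v u hvr hur
  simp only [List.length_append, FreeGroup.invRev_length] at hul hvl
  refine Finset.mem_biUnion.2 ⟨z.length, ?_, Finset.mem_image.2 ⟨(z, v' ++ u'), ?_, ?_⟩⟩
  · simp only [Finset.mem_filter, Finset.mem_range]; omega
  · refine Finset.mem_product.2 ⟨mem_redWords.2 ⟨rfl, hvr.infix (List.suffix_append _ _).isInfix⟩,
      mem_wordsOf.2 ⟨?_, hr, ?_⟩⟩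
    · simp only [List.length_append]; omega
    · simp only [eval_append, eval_invRev] at hg ⊢
      rw [← hg]; group
  · have : j - z.length = v'.length := by omega
    simp [this]

/-- A bound for the number of relations of length `ℓ` by way of a cut of each of them. -/
lemma card_wordsOf_one_le {ℓ q k B : ℕ}
    (hcut : ∀ w ∈ wordsOf R 1 ℓ, ∃ (i n : ℕ) (p : Word m), i + n ≤ ℓ ∧ q ≤ n ∧ n + q ≤ ℓ ∧
      FreeGroup.IsReduced p ∧ p.length ≤ k ∧ eval R ((w.drop i).take n) = eval R p)
    (hB : ∀ (i n : ℕ) (p : Word m), i + n ≤ ℓ → q ≤ n → n + q ≤ ℓ → p.length ≤ k →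
      (wordsOf R (eval R p) n).card * (pairsOf R (eval R p)⁻¹ i (ℓ - i - n)).card ≤ B) :
    (wordsOf R 1 ℓ).card ≤
      (ℓ + 1) * ((ℓ + 1) * ((∑ t ∈ Finset.range (k + 1), (redWords m t).card) * B)) := by
  classical
  let P : Finset (Word m) := (Finset.range (k + 1)).biUnion fun t => redWords m t
  let I : Finset (ℕ × ℕ × Word m) :=
    (Finset.range (ℓ + 1) ×ˢ Finset.range (ℓ + 1) ×ˢ P).filter fun x =>
      x.1 + x.2.1 ≤ ℓ ∧ q ≤ x.2.1 ∧ x.2.1 + q ≤ ℓ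
  have hcover : wordsOf R 1 ℓ ⊆ I.biUnion fun x =>
      ((wordsOf R (eval R x.2.2) x.2.1) ×ˢ (pairsOf R (eval R x.2.2)⁻¹ x.1 (ℓ - x.1 - x.2.1))).image
        fun y : Word m × Word m × Word m => y.2.1 ++ (y.1 ++ y.2.2) := by
    intro w hw
    obtain ⟨i, n, p, h1, h2, h3, h4, h5, h6⟩ := hcut w hw
    obtain ⟨hwl, hwr, hwe⟩ := mem_wordsOf.1 hw
    refine Finset.mem_biUnion.2 ⟨(i, n, p), ?_, Finset.mem_image.2
      ⟨((w.drop i).take n, w.take i, (w.drop i).drop n), Finset.mem_product.2 ⟨?_, ?_⟩, by simp⟩⟩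
    · refine Finset.mem_filter.2 ⟨?_, h1, h2, h3⟩
      refine Finset.mem_product.2 ⟨Finset.mem_range.2 (by omega),
        Finset.mem_product.2 ⟨Finset.mem_range.2 (by simp only; omega), ?_⟩⟩
      exact Finset.mem_biUnion.2 ⟨p.length, Finset.mem_range.2 (by omega), mem_redWords.2 ⟨rfl, h4⟩⟩
    · refine mem_wordsOf.2 ⟨by simp; omega, ?_, h6⟩
      exact hwr.infix ((List.take_prefix _ _).isInfix.trans (List.drop_suffix _ _).isInfix)
    · refine Finset.mem_filter.2 ⟨Finset.mem_product.2 ⟨mem_redWords.2 ⟨by simp; omega, ?_⟩,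
        mem_redWords.2 ⟨by simp; omega, ?_⟩⟩, ?_⟩
      · exact hwr.infix (List.take_prefix _ _).isInfix
      · exact hwr.infix ((List.drop_suffix _ _).isInfix.trans (List.drop_suffix _ _).isInfix)
      · have h7 : w = w.take i ++ ((w.drop i).take n ++ (w.drop i).drop n) := by simp
        rw [h7, eval_append, eval_append, h6] at hwe
        simp only
        rw [eq_inv_iff_mul_eq_one, mul_assoc]
        rw [← mul_assoc] at hwe
        exact mul_eq_one_comm.1 hwe
  refine (Finset.card_le_card hcover).trans ?_
  refine (Finset.card_biUnion_le_card_mul _ _ B ?_).trans ?_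
  · rintro ⟨i, n, p⟩ hx
    obtain ⟨hx, h1, h2, h3⟩ := Finset.mem_filter.1 hx
    refine Finset.card_image_le.trans ?_
    rw [Finset.card_product]
    refine hB i n p h1 h2 h3 ?_
    obtain ⟨t, ht, hp⟩ := Finset.mem_biUnion.1 (Finset.mem_product.1 (Finset.mem_product.1 hx).2).2
    have := (mem_redWords.1 hp).1
    have := Finset.mem_range.1 ht
    simp only at *
    omega
  · have h1 : I.card ≤ (ℓ + 1) * ((ℓ + 1) * P.card) := by
      refine (Finset.card_le_card (Finset.filter_subset _ _)).trans ?_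
      simp [Finset.card_product]
    have h2 : P.card ≤ ∑ t ∈ Finset.range (k + 1), (redWords m t).card := Finset.card_biUnion_le
    calc I.card * B ≤ ((ℓ + 1) * ((ℓ + 1) * P.card)) * B := Nat.mul_le_mul_right _ h1
      _ = (ℓ + 1) * ((ℓ + 1) * (P.card * B)) := by ring
      _ ≤ _ := by gcongr

end Counting

end Cogrowth

namespace Cogrowth

section Growth

/-- The exponent in the inductive bound. -/
noncomputable def expo (α β x : ℝ) : ℝ := α * x - β * √x

variable {α β η s : ℝ}

lemma expo_add_sub_le (hβ : 0 ≤ β) (hs : 0 < s) (hαβ : β ≤ (α - 1) * √s) {x y : ℝ} (hx : s ≤ x)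
    (hxy : x ≤ y) : expo α β x + (y - x) ≤ expo α β y := by
  have h1 : √s ≤ √x := Real.sqrt_le_sqrt hx
  have h2 : √x ≤ √y := Real.sqrt_le_sqrt hxy
  have h3 : 0 < √s := Real.sqrt_pos.2 hs
  have h4 : √x * √x = x := Real.mul_self_sqrt (by linarith)
  have h5 : √y * √y = y := Real.mul_self_sqrt (by linarith)
  have h6 : 0 ≤ α - 1 := by
    by_contra h
    nlinarith
  have h7 : β * (√y - √x) ≤ (α - 1) * (y - x) := by
    have : y - x = (√y + √x) * (√y - √x) := by linear_combination h4 - h5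
    rw [this, ← mul_assoc]
    apply mul_le_mul_of_nonneg_right _ (by linarith)
    refine hαβ.trans (mul_le_mul_of_nonneg_left ?_ h6)
    linarith
  unfold expo
  linarith

lemma le_expo (hs : 0 < s) (hα : 1 ≤ α) (hαβ : β ≤ (α - 1) * √s) {x : ℝ} (hx : s ≤ x) :
    x ≤ expo α β x := by
  have h1 : √s ≤ √x := Real.sqrt_le_sqrt hx
  have h4 : √x * √x = x := Real.mul_self_sqrt (by linarith)
  have h3 : 0 < √s := Real.sqrt_pos.2 hs
  have h5 : β * √x ≤ (α - 1) * x := by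
    calc β * √x ≤ (α - 1) * √s * √x := mul_le_mul_of_nonneg_right hαβ (by positivity)
      _ ≤ (α - 1) * √x * √x := by
        gcongr
      _ = (α - 1) * x := by rw [mul_assoc, h4]
  unfold expo
  linarith

lemma expo_add_expo_le {κ ℓ k x y : ℝ} (hα : 1 ≤ α) (hκ : 0 ≤ κ) (hℓ : 0 ≤ ℓ) (hη : 1 / 2 ≤ η)
    (hk : k ≤ κ * √ℓ) (hxy : x + y = ℓ + 2 * k) (hk0 : 0 ≤ k) (hx : ℓ / 4 ≤ x) (hy : ℓ / 4 ≤ y) :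
    η * expo α (20 * α * κ) x + η * expo α (20 * α * κ) y ≤
      η * expo α (20 * α * κ) ℓ - 2 * (κ * √ℓ) := by
  have h1 : 13 / 10 * √ℓ ≤ √x + √y := by
    have hx0 : 0 ≤ x := by linarith
    have hy0 : 0 ≤ y := by linarith
    have h2 : √x * √x = x := Real.mul_self_sqrt hx0
    have h3 : √y * √y = y := Real.mul_self_sqrt hy0
    have h4 : √ℓ * √ℓ = ℓ := Real.mul_self_sqrt hℓ
    have h5 : 2 / 5 * ℓ ≤ √x * √y := by
      rw [← Real.sqrt_mul hx0]
      apply Real.le_sqrt_of_sq_le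
      nlinarith [mul_nonneg (sub_nonneg.2 hx) (sub_nonneg.2 hy), mul_nonneg hℓ hk0]
    rw [← sq_le_sq₀ (by positivity) (by positivity)]
    nlinarith
  have h2 : 0 ≤ α * κ * (√x + √y - 13 / 10 * √ℓ) :=
    mul_nonneg (by positivity) (by linarith)
  have h3 : α * k ≤ α * (κ * √ℓ) := mul_le_mul_of_nonneg_left hk (by linarith)
  have h4 : 0 ≤ κ * √ℓ := by positivity
  have h5 : κ * √ℓ ≤ α * (κ * √ℓ) := le_mul_of_one_le_left h4 hα
  have h6 : expo α (20 * α * κ) x + expo α (20 * α * κ) y ≤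
      expo α (20 * α * κ) ℓ - 4 * (κ * √ℓ) := by
    unfold expo
    have : α * x + α * y = α * ℓ + 2 * (α * k) := by rw [← mul_add, hxy]; ring
    nlinarith
  have h7 := mul_le_mul_of_nonneg_left h6 (show 0 ≤ η by linarith)
  nlinarith

lemma poly_mul_le_rpow {b ℓ : ℝ} (hb : 3 ≤ b) (hℓ : 20000 ≤ ℓ) :
    (ℓ + 1) ^ 6 * b ^ (4 : ℝ) ≤ b ^ √ℓ := by
  have hr : 141 ≤ √ℓ := Real.le_sqrt_of_sq_le (by norm_num; linarith)
  have hsq : √ℓ * √ℓ = ℓ := Real.mul_self_sqrt (by linarith)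
  set r := √ℓ
  have hlog : Real.log (1.1 * r) ≤ 1.1 * r / 128 - 1 + 4.8521 := by
    have h1 : 1.1 * r = (1.1 * r / 128) * 2 ^ 7 := by ring
    rw [h1, Real.log_mul (by positivity) (by positivity), Real.log_pow]
    have h2 := Real.log_le_sub_one_of_pos (show 0 < 1.1 * r / 128 by positivity)
    have h3 := Real.log_two_lt_d9
    push_cast
    linarith
  have hpow : (ℓ + 1) ^ 6 ≤ (1.1 * r) ^ 12 := by
    calc (ℓ + 1) ^ 6 ≤ ((1.1 * r) ^ 2) ^ 6 := by
          apply pow_le_pow_left₀ (by linarith)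
          nlinarith
      _ = _ := by ring
  have h3r : (1.1 * r) ^ 12 ≤ b ^ (r - 4) := by
    calc (1.1 * r) ^ 12 ≤ (3 : ℝ) ^ (r - 4) := by
          rw [← Real.log_le_log_iff (by positivity) (by positivity), Real.log_pow,
            Real.log_rpow (by norm_num)]
          have := Real.log_three_gt_d9
          push_cast
          nlinarith
      _ ≤ _ := Real.rpow_le_rpow (by norm_num) hb (by linarith)
  calc (ℓ + 1) ^ 6 * b ^ (4 : ℝ) ≤ b ^ (r - 4) * b ^ (4 : ℝ) :=
        mul_le_mul_of_nonneg_right (hpow.trans h3r) (by positivity)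
    _ = b ^ r := by rw [← Real.rpow_add (by linarith)]; congr 1; ring

variable {m : ℕ} {R : Finset (Word m)}

lemma card_wordsOf_zero_le : (wordsOf R 1 0).card ≤ 1 := by
  refine Finset.card_le_one.2 ?_
  intro u hu v hv
  rw [List.length_eq_zero_iff.1 (mem_wordsOf.1 hu).1,
    List.length_eq_zero_iff.1 (mem_wordsOf.1 hv).1]

lemma cast_base (hm : 2 ≤ m) : ((2 * m - 1 : ℕ) : ℝ) = 2 * (m : ℝ) - 1 := by
  rw [Nat.cast_sub (by omega)]; push_cast; ring

lemma three_le_base (hm : 2 ≤ m) : (3 : ℝ) ≤ 2 * (m : ℝ) - 1 := by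
  have : (2 : ℝ) ≤ m := by exact_mod_cast hm
  linarith

/-- The inductive bound at long lengths bounds the number of short relations, too. -/
lemma pow_mul_card_le (hm : 2 ≤ m) (hα : 1 ≤ α) (hβ : 0 ≤ β) (hs : 0 < s)
    (hαβ : β ≤ (α - 1) * √s) (hη : 1 / 2 ≤ η) {N n t : ℕ}
    (hN : ∀ n : ℕ, s ≤ n → n ≤ N →
      ((wordsOf R 1 n).card : ℝ) ≤ (2 * (m : ℝ) - 1) ^ (η * expo α β n))
    (hsN : s + 1 ≤ N) (hnt : n + 2 * t ≤ N) :
    (2 * (m : ℝ) - 1) ^ t * ((wordsOf R 1 n).card : ℝ) ≤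
      (2 * (m : ℝ) - 1) ^ (1 + η * expo α β N) := by
  have hb := three_le_base hm
  set b : ℝ := 2 * (m : ℝ) - 1 with hbdef
  have hb1 : 1 ≤ b := by linarith
  have hb0 : 0 < b := by linarith
  have hntR : (n : ℝ) + 2 * t ≤ N := by exact_mod_cast hnt
  rcases Nat.eq_zero_or_pos n with rfl | hn
  · have h0 : ((wordsOf R 1 0).card : ℝ) ≤ 1 := by exact_mod_cast card_wordsOf_zero_le
    have h1 : (t : ℝ) ≤ 1 + η * expo α β N := by
      have h2 := le_expo hs hα hαβ (show s ≤ (N : ℝ) by linarith)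
      push_cast at hntR
      have h3 : 1 / 2 * (N : ℝ) ≤ η * expo α β N :=
        mul_le_mul hη h2 (by positivity) (by linarith)
      linarith
    calc b ^ t * ((wordsOf R 1 0).card : ℝ) ≤ b ^ t * 1 :=
          mul_le_mul_of_nonneg_left h0 (by positivity)
      _ = b ^ (t : ℝ) := by rw [mul_one, Real.rpow_natCast]
      _ ≤ _ := Real.rpow_le_rpow_of_exponent_le hb1 h1
  · set j := (N - n) / 2 with hj
    have htj : t ≤ j := by omega
    have hnj : n + 2 * j ≤ N := by omega
    have hnj' : N ≤ n + 2 * j + 1 := by omega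
    have h1 := card_wordsOf_mul_pow_le (R := R) hm hn j
    have h2 : ((wordsOf R 1 n).card : ℝ) * b ^ j ≤ b * ((wordsOf R 1 (n + 2 * j)).card : ℝ) := by
      rw [hbdef, ← cast_base hm]
      exact_mod_cast h1
    have hlow : s ≤ ((n + 2 * j : ℕ) : ℝ) := by
      have : (N : ℝ) ≤ ((n + 2 * j : ℕ) : ℝ) + 1 := by exact_mod_cast hnj'
      linarith
    have hupp : ((n + 2 * j : ℕ) : ℝ) ≤ N := by exact_mod_cast hnj
    have h3 := hN (n + 2 * j) hlow hnj
    have h4 := expo_add_sub_le hβ hs hαβ hlow hupp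
    have h5 : η * expo α β ((n + 2 * j : ℕ) : ℝ) ≤ η * expo α β N :=
      mul_le_mul_of_nonneg_left (by linarith) (by linarith)
    calc b ^ t * ((wordsOf R 1 n).card : ℝ) ≤ b ^ j * ((wordsOf R 1 n).card : ℝ) := by
          gcongr
      _ ≤ b * ((wordsOf R 1 (n + 2 * j)).card : ℝ) := by rw [mul_comm]; exact h2
      _ ≤ b * b ^ (η * expo α β ((n + 2 * j : ℕ) : ℝ)) := by gcongr
      _ ≤ b * b ^ (η * expo α β N) := by
          gcongr
      _ = _ := by rw [Real.rpow_add hb0, Real.rpow_one]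

/-- The inductive step. -/
lemma card_wordsOf_le_of_cut (hm : 2 ≤ m) (hα : 1 ≤ α) {κ : ℝ} (hκ : 1 ≤ κ) (hs : 0 < s)
    (hαβ : 20 * α * κ ≤ (α - 1) * √s) (hη : 1 / 2 ≤ η) {ℓ : ℕ} (hℓ : 20000 ≤ ℓ)
    (hsℓ : 4 * s ≤ ℓ) (hκℓ : 100 * (κ * √ℓ) ≤ ℓ)
    (hN : ∀ n : ℕ, s ≤ n → n < ℓ →
      ((wordsOf R 1 n).card : ℝ) ≤ (2 * (m : ℝ) - 1) ^ (η * expo α (20 * α * κ) n))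
    (hcut : ∀ w ∈ wordsOf R 1 ℓ, ∃ (i n : ℕ) (p : Word m), i + n ≤ ℓ ∧ ℓ / 4 ≤ n ∧ n + ℓ / 4 ≤ ℓ ∧
      FreeGroup.IsReduced p ∧ p.length ≤ ⌊κ * √ℓ⌋₊ ∧ eval R ((w.drop i).take n) = eval R p) :
    ((wordsOf R 1 ℓ).card : ℝ) ≤ (2 * (m : ℝ) - 1) ^ (η * expo α (20 * α * κ) ℓ) := by
  have hb := three_le_base hm
  have hcb := cast_base hm
  set b : ℝ := 2 * (m : ℝ) - 1 with hbdef
  have hb1 : 1 ≤ b := by linarith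
  have hb0 : 0 < b := by linarith
  set β := 20 * α * κ with hβdef
  have hβ : 0 ≤ β := by positivity
  set K := κ * √ℓ with hK
  set k := ⌊K⌋₊ with hk
  have hℓR : (20000 : ℝ) ≤ ℓ := by exact_mod_cast hℓ
  have hr : 141 ≤ √(ℓ : ℝ) := Real.le_sqrt_of_sq_le (by norm_num; linarith)
  have hrK : √(ℓ : ℝ) ≤ K := le_mul_of_one_le_left (by positivity) hκ
  have hkK : (k : ℝ) ≤ K := Nat.floor_le (by positivity)
  have hKk : K < k + 1 := Nat.lt_floor_add_one K
  have hk140 : 140 ≤ k := by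
    have : (140 : ℝ) < k + 1 := by linarith
    have : (140 : ℕ) < k + 1 := by exact_mod_cast this
    omega
  have hkℓ : 100 * k ≤ ℓ := by
    have : (100 : ℝ) * k ≤ ℓ := by linarith
    exact_mod_cast this
  have hq : ℓ / 4 + k + 2 ≤ ℓ := by omega
  -- bounds for sums of relation counts
  have hrange : ∀ n : ℕ, ℓ / 4 ≤ n → n + ℓ / 4 ≤ ℓ → s + 1 ≤ ((n + k : ℕ) : ℝ) ∧ n + k + 1 ≤ ℓ ∧
      (ℓ : ℝ) / 4 ≤ ((n + k : ℕ) : ℝ) := by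
    intro n h1 h2
    have h3 : ℓ + 400 ≤ 4 * (n + k) := by omega
    have h4 : (ℓ : ℝ) + 400 ≤ 4 * ((n + k : ℕ) : ℝ) := by exact_mod_cast h3
    refine ⟨by linarith, by omega, by linarith⟩
  have hsum : ∀ N n t : ℕ, s + 1 ≤ ((N + k : ℕ) : ℝ) → N + k + 1 ≤ ℓ → n + 2 * t ≤ N →
      b ^ t * (∑ n' ∈ Finset.range (n + k + 1), ((wordsOf R 1 n').card : ℝ)) ≤
        (ℓ + 1) * b ^ (1 + η * expo α β ((N + k : ℕ) : ℝ)) := by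
    intro N n t h1 h2 h3
    rw [Finset.mul_sum]
    have h4 : ∀ n' ∈ Finset.range (n + k + 1), b ^ t * ((wordsOf R 1 n').card : ℝ) ≤
        b ^ (1 + η * expo α β ((N + k : ℕ) : ℝ)) := by
      intro n' hn'
      rw [Finset.mem_range] at hn'
      exact pow_mul_card_le hm hα hβ hs hαβ hη (fun n hn hnN => hN n hn (by omega)) h1 (by omega)
    refine (Finset.sum_le_card_nsmul _ _ _ h4).trans ?_
    rw [Finset.card_range, nsmul_eq_mul]
    apply mul_le_mul_of_nonneg_right _ (by positivity)
    have : n + k + 1 ≤ ℓ + 1 := by omega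
    exact_mod_cast this
  have hwords : ∀ (n : ℕ) (p : Word m), ℓ / 4 ≤ n → n + ℓ / 4 ≤ ℓ → p.length ≤ k →
      ((wordsOf R (eval R p) n).card : ℝ) ≤
        (ℓ + 1) * b ^ (1 + η * expo α β ((n + k : ℕ) : ℝ)) := by
    intro n p h1 h2 hp
    obtain ⟨h3, h4, -⟩ := hrange n h1 h2
    have h5 := hsum n n 0 h3 h4 (by omega)
    rw [pow_zero, one_mul] at h5
    refine le_trans ?_ h5
    exact_mod_cast card_wordsOf_le (R := R) (n := n) hp
  have hpairs : ∀ (i j : ℕ) (p : Word m), ℓ / 4 ≤ i + j → i + j + ℓ / 4 ≤ ℓ → p.length ≤ k →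
      ((pairsOf R (eval R p)⁻¹ i j).card : ℝ) ≤
        (ℓ + 1) * (b * ((ℓ + 1) * b ^ (1 + η * expo α β ((i + j + k : ℕ) : ℝ)))) := by
    intro i j p h1 h2 hp
    obtain ⟨h3, h4, -⟩ := hrange (i + j) h1 h2
    have h5 : ((pairsOf R (eval R p)⁻¹ i j).card : ℝ) ≤
        ∑ t ∈ (Finset.range (i + j + 1)).filter (fun t => 2 * t ≤ i + j),
          ((redWords m t).card : ℝ) * ((wordsOf R (eval R p)⁻¹ (i + j - 2 * t)).card : ℝ) := by
      exact_mod_cast card_pairsOf_le (R := R) (eval R p)⁻¹ i j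
    refine h5.trans ?_
    have h6 : ∀ t ∈ (Finset.range (i + j + 1)).filter (fun t => 2 * t ≤ i + j),
        ((redWords m t).card : ℝ) * ((wordsOf R (eval R p)⁻¹ (i + j - 2 * t)).card : ℝ) ≤
          b * ((ℓ + 1) * b ^ (1 + η * expo α β ((i + j + k : ℕ) : ℝ))) := by
      intro t ht
      have ht := (Finset.mem_filter.1 ht).2
      have h7 : ((redWords m t).card : ℝ) ≤ b ^ (t + 1) := by
        rw [← hcb]; exact_mod_cast card_redWords_le hm t
      have h8 : ((wordsOf R (eval R p)⁻¹ (i + j - 2 * t)).card : ℝ) ≤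
          ∑ n' ∈ Finset.range (i + j - 2 * t + k + 1), ((wordsOf R 1 n').card : ℝ) := by
        rw [← eval_invRev]
        exact_mod_cast card_wordsOf_le (R := R) (n := i + j - 2 * t)
          (p := FreeGroup.invRev p) (k := k) (by rwa [FreeGroup.invRev_length])
      calc _ ≤ b ^ (t + 1) *
            ∑ n' ∈ Finset.range (i + j - 2 * t + k + 1), ((wordsOf R 1 n').card : ℝ) := by
            gcongr
        _ = b * (b ^ t *
            ∑ n' ∈ Finset.range (i + j - 2 * t + k + 1), ((wordsOf R 1 n').card : ℝ)) := by ring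
        _ ≤ _ := mul_le_mul_of_nonneg_left (hsum _ _ t h3 h4 (by omega)) hb0.le
    refine (Finset.sum_le_card_nsmul _ _ _ h6).trans ?_
    rw [nsmul_eq_mul]
    apply mul_le_mul_of_nonneg_right _ (by positivity)
    have h9 : ((Finset.range (i + j + 1)).filter (fun t => 2 * t ≤ i + j)).card ≤ ℓ + 1 := by
      refine (Finset.card_filter_le _ _).trans ?_
      rw [Finset.card_range]; omega
    exact_mod_cast h9
  set Br : ℝ := (ℓ + 1) ^ 3 * b ^ (3 + (η * expo α β ℓ - 2 * K)) with hBr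
  have hmain := card_wordsOf_one_le (R := R) (ℓ := ℓ) (q := ℓ / 4) (k := k) (B := ⌊Br⌋₊) hcut (by
    intro i n p h1 h2 h3 hp
    apply Nat.le_floor
    push_cast
    have hij : i + (ℓ - i - n) = ℓ - n := by omega
    have h4 := hwords n p h2 h3 hp
    have h5 := hpairs i (ℓ - i - n) p (by omega) (by omega) hp
    rw [hij] at h5
    obtain ⟨-, -, h6⟩ := hrange n h2 h3
    obtain ⟨-, -, h7⟩ := hrange (ℓ - n) (by omega) (by omega)
    have h8 : ((n + k : ℕ) : ℝ) + ((ℓ - n + k : ℕ) : ℝ) = ℓ + 2 * k := by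
      have : (n + k) + (ℓ - n + k) = ℓ + 2 * k := by omega
      exact_mod_cast this
    have h9 := expo_add_expo_le (κ := κ) hα (by linarith) (by positivity) hη hkK h8
      (by positivity) h6 h7
    calc _ ≤ ((ℓ + 1) * b ^ (1 + η * expo α β ((n + k : ℕ) : ℝ))) *
          ((ℓ + 1) * (b * ((ℓ + 1) * b ^ (1 + η * expo α β ((ℓ - n + k : ℕ) : ℝ))))) := by
          gcongr
      _ = (ℓ + 1) ^ 3 * b ^ (3 + (η * expo α β ((n + k : ℕ) : ℝ) +
          η * expo α β ((ℓ - n + k : ℕ) : ℝ))) := by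
          have e : ∀ X Y : ℝ, b ^ (1 + X) * (b * b ^ (1 + Y)) = b ^ (3 + (X + Y)) := by
            intro X Y
            rw [show 3 + (X + Y) = (1 + X) + (1 + (1 + Y)) by ring, Real.rpow_add hb0 (1 + X),
              Real.rpow_add hb0 1 (1 + Y), Real.rpow_one]
          rw [← e]
          ring
      _ ≤ Br := by
          rw [hBr]
          gcongr)
  have hmainR : ((wordsOf R 1 ℓ).card : ℝ) ≤ (ℓ + 1) * ((ℓ + 1) *
      ((∑ t ∈ Finset.range (k + 1), ((redWords m t).card : ℝ)) * (⌊Br⌋₊ : ℝ))) := by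
    exact_mod_cast hmain
  have hball : ∑ t ∈ Finset.range (k + 1), ((redWords m t).card : ℝ) ≤ (ℓ + 1) * b ^ (k + 1) := by
    have h1 : ∀ t ∈ Finset.range (k + 1), ((redWords m t).card : ℝ) ≤ b ^ (k + 1) := by
      intro t ht
      have h7 : ((redWords m t).card : ℝ) ≤ b ^ (t + 1) := by
        rw [← hcb]; exact_mod_cast card_redWords_le hm t
      refine h7.trans (pow_le_pow_right₀ hb1 ?_)
      have := Finset.mem_range.1 ht
      omega
    refine (Finset.sum_le_card_nsmul _ _ _ h1).trans ?_
    rw [Finset.card_range, nsmul_eq_mul]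
    apply mul_le_mul_of_nonneg_right _ (by positivity)
    have : k + 1 ≤ ℓ + 1 := by omega
    exact_mod_cast this
  have hBr0 : (⌊Br⌋₊ : ℝ) ≤ Br := Nat.floor_le (by positivity)
  have hpoly := poly_mul_le_rpow hb hℓR
  calc ((wordsOf R 1 ℓ).card : ℝ)
      ≤ (ℓ + 1) * ((ℓ + 1) * (((ℓ + 1) * b ^ (k + 1)) * Br)) := by
        refine hmainR.trans ?_
        gcongr
    _ = ((ℓ + 1 : ℝ) ^ 6 * b ^ (4 : ℝ)) * b ^ (k + (η * expo α β ℓ - 2 * K)) := by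
        rw [hBr, ← Real.rpow_natCast b (k + 1)]
        have : b ^ (((k + 1 : ℕ) : ℝ)) * b ^ (3 + (η * expo α β ℓ - 2 * K)) =
            b ^ (4 : ℝ) * b ^ (k + (η * expo α β ℓ - 2 * K)) := by
          rw [← Real.rpow_add hb0, ← Real.rpow_add hb0]
          congr 1
          push_cast
          ring
        linear_combination (ℓ + 1 : ℝ) ^ 6 * this
    _ ≤ b ^ √(ℓ : ℝ) * b ^ (k + (η * expo α β ℓ - 2 * K)) := by gcongr
    _ = b ^ (√(ℓ : ℝ) + (k + (η * expo α β ℓ - 2 * K))) := (Real.rpow_add hb0 _ _).symm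
    _ ≤ _ := Real.rpow_le_rpow_of_exponent_le hb1 (by linarith)

end Growth

end Cogrowth

namespace Cogrowth

section Main

variable {m : ℕ} {R : Finset (Word m)}

/-- A presentation with a nontrivial reduced relation has isoperimetric constant at most one and a
nonempty relator. -/
lemma isoperimetric_le_one {lam : ℕ} (hlam : ∀ r ∈ R, r.length ≤ lam) {C : ℝ}
    (hiso : ∀ D : VanKampenDiagram R, D.IsMinimal →
      (D.boundaryWord.length : ℝ) ≥ C * (D.area : ℝ))
    {w : Word m} (hw : w ≠ []) (hr : FreeGroup.IsReduced w) (he : eval R w = 1) :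
    C ≤ 1 ∧ 1 ≤ lam := by
  classical
  have hex : ∃ n, ∃ v : Word m, v ≠ [] ∧ FreeGroup.IsReduced v ∧ eval R v = 1 ∧ v.length = n :=
    ⟨_, w, hw, hr, he, rfl⟩
  obtain ⟨v, hv, hvr, hve, hvl⟩ := Nat.find_spec hex
  obtain ⟨D, rfl, hD⟩ := exists_minimal_diagram hve
  have h1 := D.length_le_area hv hvr (fun u hu hue hun => by
    rw [hvl]; exact Nat.find_min' hex ⟨u, hun, hu, hue, rfl⟩)
  have h2 : 0 < D.boundaryWord.length := List.length_pos_iff_ne_nil.2 hv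
  have h3 : 0 < D.area := by omega
  refine ⟨?_, D.lam_pos hlam hv h3⟩
  have h4 := hiso D hD
  have h5 : (D.boundaryWord.length : ℝ) ≤ D.area := by exact_mod_cast h1
  have h6 : (0 : ℝ) < D.area := by exact_mod_cast h3
  by_contra hC
  nlinarith

lemma exists_cut_of_isoperimetric {lam : ℕ} (hlam : ∀ r ∈ R, r.length ≤ lam) {C : ℝ} (hC : 0 < C)
    (hiso : ∀ D : VanKampenDiagram R, D.IsMinimal →
      (D.boundaryWord.length : ℝ) ≥ C * (D.area : ℝ)) {ℓ : ℕ} (hℓ : 4 ≤ ℓ) :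
    ∀ w ∈ wordsOf R 1 ℓ, ∃ (i n : ℕ) (p : Word m), i + n ≤ ℓ ∧ ℓ / 4 ≤ n ∧ n + ℓ / 4 ≤ ℓ ∧
      FreeGroup.IsReduced p ∧ p.length ≤ ⌊√(lam / C) * √ℓ⌋₊ ∧
        eval R ((w.drop i).take n) = eval R p := by
  intro w hw
  obtain ⟨rfl, -, he⟩ := mem_wordsOf.1 hw
  obtain ⟨D, rfl, hD⟩ := exists_minimal_diagram he
  refine exists_cut hlam D ?_ hℓ
  set k := ⌊√(lam / C) * √(D.boundaryWord.length : ℝ)⌋₊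
  have h1 : √(lam / C) * √(D.boundaryWord.length : ℝ) < k + 1 := Nat.lt_floor_add_one _
  have h2 : (D.area : ℝ) ≤ D.boundaryWord.length / C := by
    rw [le_div_iff₀ hC, mul_comm]; exact hiso D hD
  have h3 : (lam : ℝ) * D.area < (k + 1) ^ 2 := by
    calc (lam : ℝ) * D.area ≤ lam * (D.boundaryWord.length / C) := by gcongr
      _ = (√(lam / C) * √(D.boundaryWord.length : ℝ)) ^ 2 := by
        rw [mul_pow, Real.sq_sqrt (by positivity), Real.sq_sqrt (by positivity)]; ring
      _ < _ := by gcongr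
  exact_mod_cast h3

lemma exp_two_hundred_div_ge {y : ℝ} (hy : 0 < y) (hy' : y ≤ 144) : 4 ≤ Real.exp (200 / y) := by
  have h1 : Real.log 4 ≤ 200 / y := by
    rw [le_div_iff₀ hy]
    have h2 : Real.log 4 = 2 * Real.log 2 := by
      rw [show (4 : ℝ) = 2 ^ 2 by norm_num, Real.log_pow]; norm_num
    have h3 := Real.log_two_lt_d9
    have h4 : 0 < Real.log 2 := Real.log_pos (by norm_num)
    rw [h2]
    nlinarith
  calc (4 : ℝ) = Real.exp (Real.log 4) := (Real.exp_log (by norm_num)).symm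
    _ ≤ _ := Real.exp_le_exp.2 h1

lemma card_wordsOf_le_pow (hm : 2 ≤ m) (ℓ : ℕ) :
    (wordsOf R 1 ℓ).card ≤ (2 * m - 1) ^ (ℓ + 1) := by
  classical
  exact (Finset.card_le_card (Finset.filter_subset _ _)).trans (card_redWords_le hm ℓ)

/-- The inductive bound at all lengths. -/
lemma card_wordsOf_le_rpow_expo (hm : 2 ≤ m) {lam : ℕ} (hlam : ∀ r ∈ R, r.length ≤ lam) {C : ℝ}
    (hC : 0 < C) (hC1 : C ≤ 1) (hlam1 : 1 ≤ lam)
    (hiso : ∀ D : VanKampenDiagram R, D.IsMinimal →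
      (D.boundaryWord.length : ℝ) ≥ C * (D.area : ℝ))
    {A η x : ℝ} (hA : 1 < A) (hη : 1 / 2 ≤ η) (hCA : 144 ≤ C * √A) (hx : x = 1 / (C * √A))
    (hW : ∀ ℓ : ℕ, A * (lam : ℝ) / 4 ≤ (ℓ : ℝ) → (ℓ : ℝ) ≤ A * (lam : ℝ) →
      ((wordsOf R 1 ℓ).card : ℝ) ≤ (2 * (m : ℝ) - 1) ^ (η * (ℓ : ℝ))) (ℓ : ℕ)
    (hℓ : A * (lam : ℝ) / 4 ≤ (ℓ : ℝ)) :
    ((wordsOf R 1 ℓ).card : ℝ) ≤ (2 * (m : ℝ) - 1) ^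
      (η * expo (1 / (1 - 40 * x)) (20 * (1 / (1 - 40 * x)) * √(lam / C)) ℓ) := by
  have hb := three_le_base hm
  have hlamR : (1 : ℝ) ≤ lam := by exact_mod_cast hlam1
  have hA0 : 0 < A := by linarith
  have hx0 : 0 < x := by rw [hx]; positivity
  have hx1 : x ≤ 1 / 144 := by
    rw [hx]
    exact one_div_le_one_div_of_le (by norm_num) hCA
  have hden : 0 < 1 - 40 * x := by linarith
  have hα : 1 ≤ 1 / (1 - 40 * x) := by
    rw [le_div_iff₀ hden]; linarith
  have hα' : 1 / (1 - 40 * x) - 1 = 40 * x * (1 / (1 - 40 * x)) := by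
    field_simp; ring
  set α := 1 / (1 - 40 * x)
  set κ := √(lam / C) with hκdef
  set s := A * (lam : ℝ) / 4 with hsdef
  have hs : 0 < s := by positivity
  have hκ : 1 ≤ κ := by
    apply Real.le_sqrt_of_sq_le
    rw [one_pow, le_div_iff₀ hC]
    linarith
  have hsqA : √A * √A = A := Real.mul_self_sqrt hA0.le
  have hAC : 144 ^ 2 ≤ A * C := by
    have h1 : (144 : ℝ) ^ 2 ≤ (C * √A) ^ 2 := by gcongr
    have h2 : (C * √A) ^ 2 = C * (A * C) := by rw [mul_pow, Real.sq_sqrt hA0.le]; ring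
    have h3 : C * (A * C) ≤ 1 * (A * C) := by gcongr
    linarith
  have hA2 : 20736 ≤ A := by nlinarith
  have hκs : κ ≤ 2 * x * √s := by
    rw [hκdef]
    apply Real.sqrt_le_iff.2
    refine ⟨by positivity, ?_⟩
    rw [mul_pow, Real.sq_sqrt hs.le, mul_pow, hx, div_pow, mul_pow, Real.sq_sqrt hA0.le, hsdef,
      div_le_iff₀ hC]
    have : 2 ^ 2 * (1 ^ 2 / (C ^ 2 * A)) * (A * (lam : ℝ) / 4) * C = lam / C := by
      field_simp
      norm_num
    rw [this, le_div_iff₀ hC]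
    nlinarith
  have hαβ : 20 * α * κ ≤ (α - 1) * √s := by
    rw [hα']
    have : 0 ≤ 20 * α := by positivity
    calc 20 * α * κ ≤ 20 * α * (2 * x * √s) := mul_le_mul_of_nonneg_left hκs this
      _ = _ := by ring
  induction ℓ using Nat.strong_induction_on with
  | _ ℓ ih =>
  rcases le_or_gt (ℓ : ℝ) (A * lam) with hle | hgt
  · refine (hW ℓ hℓ hle).trans (Real.rpow_le_rpow_of_exponent_le (by linarith) ?_)
    exact mul_le_mul_of_nonneg_left (le_expo hs hα hαβ hℓ) (by linarith)
  · have hℓA : A ≤ ℓ := by nlinarith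
    have hℓ2 : 20000 ≤ ℓ := by
      have : (20000 : ℝ) ≤ ℓ := by linarith
      exact_mod_cast this
    refine card_wordsOf_le_of_cut hm hα hκ hs hαβ hη hℓ2 (by rw [hsdef]; linarith) ?_
      (fun n hn hnℓ => ih n hnℓ hn) (exists_cut_of_isoperimetric hlam hC hiso (by omega))
    have h1 : κ * √(ℓ : ℝ) ≤ ℓ / 100 := by
      rw [hκdef, ← Real.sqrt_mul (by positivity)]
      apply Real.sqrt_le_iff.2
      refine ⟨by positivity, ?_⟩
      rw [div_mul_eq_mul_div, div_le_iff₀ hC]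
      have h2 : (lam : ℝ) * 10000 ≤ ℓ * C := by
        have : A * lam * C ≤ ℓ * C := by gcongr
        nlinarith
      have h3 : (0 : ℝ) ≤ ℓ := by positivity
      nlinarith
    linarith

end Main

end Cogrowth

theorem proposition3 :
    ∃ ε : ℝ → ℝ → ℝ,
      (∀ C : ℝ, 0 < C → Tendsto (fun A : ℝ => ε C A) atTop (𝓝 0)) ∧
      (∀ C A : ℝ, 0 < C → 1 < A → 1 + ε C A ≤ Real.exp (200 / (C * √A))) ∧
      ∀ (m : ℕ) (_hm : 2 ≤ m) (R : Finset (Cogrowth.Word m)) (lam : ℕ)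
        (_hlam : ∀ r ∈ R, r.length ≤ lam)
        (C : ℝ) (_hC : 0 < C)
        (_hiso : ∀ D : Cogrowth.VanKampenDiagram R, D.IsMinimal →
          (D.boundaryWord.length : ℝ) ≥ C * (D.area : ℝ))
        (A : ℝ) (_hA : 1 < A) (η : ℝ) (_hη : 1 / 2 ≤ η)
        (_hW : ∀ ℓ : ℕ, A * (lam : ℝ) / 4 ≤ (ℓ : ℝ) → (ℓ : ℝ) ≤ A * (lam : ℝ) →
          ((Cogrowth.W R ℓ).ncard : ℝ) ≤ (2 * (m : ℝ) - 1) ^ (η * (ℓ : ℝ)))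
        (ℓ : ℕ) (_hℓ : A * (lam : ℝ) / 4 ≤ (ℓ : ℝ)),
        ((Cogrowth.W R ℓ).ncard : ℝ) ≤
          (2 * (m : ℝ) - 1) ^ (η * (ℓ : ℝ) * (1 + ε C A)) := by
  refine ⟨fun C A => Real.exp (200 / (C * √A)) - 1, ?_, ?_, ?_⟩
  · intro C hC
    have h1 : Tendsto (fun A : ℝ => 200 / (C * √A)) atTop (𝓝 0) :=
      (Real.tendsto_sqrt_atTop.const_mul_atTop hC).const_div_atTop 200
    have h2 := ((Real.continuous_exp.tendsto 0).comp h1).sub_const 1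
    simpa using h2
  · intro C A _ _
    simp
  · intro m hm R lam hlam C hC hiso A hA η hη hW ℓ hℓ
    simp only [Cogrowth.ncard_W] at hW ⊢
    simp only [add_sub_cancel]
    have hb := Cogrowth.three_le_base hm
    have hb1 : (1 : ℝ) ≤ 2 * (m : ℝ) - 1 := by linarith
    have hA0 : 0 < A := by linarith
    rcases Nat.eq_zero_or_pos ℓ with rfl | hℓ0
    · simpa using Cogrowth.card_wordsOf_zero_le (R := R)
    rcases Finset.eq_empty_or_nonempty (Cogrowth.wordsOf R 1 ℓ) with hempty | ⟨w, hw⟩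
    · rw [hempty]
      simp only [Finset.card_empty, Nat.cast_zero]
      positivity
    obtain ⟨hwl, hwr, hwe⟩ := Cogrowth.mem_wordsOf.1 hw
    obtain ⟨hC1, hlam1⟩ := Cogrowth.isoperimetric_le_one hlam hiso
      (List.length_pos_iff_ne_nil.1 (by omega)) hwr hwe
    have hℓR : (1 : ℝ) ≤ ℓ := by exact_mod_cast hℓ0
    rcases le_or_gt (C * √A) 144 with hsmall | hlarge
    · have h1 := Cogrowth.exp_two_hundred_div_ge (by positivity) hsmall
      have h2 : ((Cogrowth.wordsOf R 1 ℓ).card : ℝ) ≤ (2 * (m : ℝ) - 1) ^ (ℓ + 1) := by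
        rw [← Cogrowth.cast_base hm]
        exact_mod_cast Cogrowth.card_wordsOf_le_pow hm ℓ
      refine h2.trans ?_
      rw [← Real.rpow_natCast]
      apply Real.rpow_le_rpow_of_exponent_le hb1
      push_cast
      have h3 : 1 / 2 * (ℓ : ℝ) ≤ η * ℓ := by gcongr
      have h4 : η * (ℓ : ℝ) * 4 ≤ η * ℓ * Real.exp (200 / (C * √A)) := by gcongr
      linarith
    · set x := 1 / (C * √A) with hx
      have hx0 : 0 < x := by positivity
      have hx1 : x ≤ 1 / 144 := one_div_le_one_div_of_le (by norm_num) hlarge.le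
      refine (Cogrowth.card_wordsOf_le_rpow_expo hm hlam hC hC1 hlam1 hiso hA hη hlarge.le hx hW
        ℓ hℓ).trans ?_
      apply Real.rpow_le_rpow_of_exponent_le hb1
      rw [mul_assoc η]
      apply mul_le_mul_of_nonneg_left _ (by linarith)
      have h1 : 0 < 1 - 40 * x := by linarith
      have h2 : 1 / (1 - 40 * x) ≤ Real.exp (200 / (C * √A)) := by
        have h3 : 200 / (C * √A) = 200 * x := by rw [hx]; ring
        rw [h3]
        refine le_trans ?_ (Real.add_one_le_exp _)
        rw [div_le_iff₀ h1]
        nlinarith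
      have h4 : 0 ≤ 20 * (1 / (1 - 40 * x)) * √((lam : ℝ) / C) * √(ℓ : ℝ) := by positivity
      unfold Cogrowth.expo
      nlinarith
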